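/- Let $T=T^*$ be a (possibly unbounded, densely defined) self-adjoint operator on a complex Hilbert space $\mathcal H$, and let $S=T\sqrt{(1+T^2)^{-1}}\in B(\mathcal H)$ be its bounded transform. A bounded operator $R\in B(\mathcal H)$ is said to commute with an operator $X$ with domain $\mathcal D(X)$ if $R\psi\in\mathcal D(X)$ and $RX\psi=XR\psi$ for all $\psi\in\mathcal D(X)$. Let $\{T\}'$ be the $*$-algebra of all bounded operators that commute with $T$, let $W^*(T)=\{T\}''$ be the commutant of $\{T\}'$ in $B(\mathcal H)$, and let $W^*(S)=C^*(S)''$, where $C^*(S)$ is the $C^*$-algebra generated by $S$ and the unit. A closed, densely defined operator $X$ is affiliated with a von Neumann algebra $A\subset B(\mathcal H)$ if it commutes with each $R\in A'$. For a Borel function $f:\sigma(T)\to\mathbb C$ put $f(T)=(f\circ u)(S)$, where $u(x)=x/\sqrt{1-x^2}$ for $x\in(-1,1)$. Here $f\circ u$ is a Borel function on $\sigma(S)\cap(-1,1)$, extended by $0$ to the points $\pm1$ if these lie in $\sigma(S)$ (they are not eigenvalues of $S$), and $g(S)$ is the Borel functional calculus of the bounded self-adjoint operator $S$: if $\mu_\psi$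 is the Borel measure on $\sigma(S)$ with $\int h\,d\mu_\psi=\langle\psi,h(S)\psi\rangle$ for all $h\in C(\sigma(S))$, then $g(S)$ has domain $\{\psi:\int|g|^2\,d\mu_\psi<\infty\}$ and $g(S)\psi=\lim_n h_n(S)\psi$ for any $h_n\in C(\sigma(S))$ with $h_n\to g$ in $L^2(\mu_\psi)$; in particular $\langle\psi,g(S)\psi\rangle=\int g\,d\mu_\psi$ for all $\psi$ in this domain. Then: 1. $W^*(T)=W^*(S)$. 2. For every bounded Borel function $f$ on $\sigma(T)$ the operator $f(T)$ is defined on all of $\mathcal H$ and lies in $W^*(T)$, and $f\mapsto f(T)$ is a unital $*$-homomorphism from the $*$-algebra $\mathcal B_b(\sigma(T))$ of bounded Borel functions $\sigma(T)\to\mathbb C$ to $W^*(T)$ that is norm-decreasing: $\|f(T)\|\le\sup_{x\in\sigma(T)}|f(x)|$. 3. For every (possibly unbounded) Borel function $f$ on $\sigma(T)$ the operator $f(T)$ is closed and densely defined, and it is affiliated with $W^*(T)$. -/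

import Mathlib

noncomputable section

open MeasureTheory
open scoped InnerProductSpace ENNReal

namespace BoundedTransform

variable {H : Type*} [NormedAddCommGroup H] [InnerProductSpace ℂ H]

/-- The spectrum `σ(T)` of an unbounded operator `T`: the complement of the set of all `z` for which
`T - z` is a bijection from the domain of `T` onto `H`. -/
def opSpectrum (T : H →ₗ.[ℂ] H) : Set ℂ :=
  {z | ¬ Function.Bijective fun x : T.domain => T x - z • (x : H)}

/-- The bounded operator `R` commutes with `X`: it maps the domain of `X` into itself and
`R X ψ = X R ψ` for all `ψ` in the domain of `X`. -/
def Commutes (X : H →ₗ.[ℂ] H) (R : H →L[ℂ] H) : Prop :=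
  ∀ ψ : X.domain, ∃ h : R ψ ∈ X.domain, R (X ψ) = X ⟨R ψ, h⟩

theorem commutes_iff {X : H →ₗ.[ℂ] H} {R : H →L[ℂ] H} :
    Commutes X R ↔ ∀ x y, (x, y) ∈ X.graph → (R x, R y) ∈ X.graph := by
  constructor
  · intro h x y hxy
    obtain ⟨ψ, hψ⟩ := (X.mem_graph_iff' ).1 hxy
    obtain ⟨h1, h2⟩ := h ψ
    simp only [Prod.mk.injEq] at hψ
    rw [← hψ.1, ← hψ.2, h2]
    exact X.mem_graph ⟨R ψ, h1⟩
  · intro h ψ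
    obtain ⟨z, hz⟩ := (X.mem_graph_iff').1 (h _ _ (X.mem_graph ψ))
    simp only [Prod.mk.injEq] at hz
    refine ⟨hz.1 ▸ z.2, ?_⟩
    have hz' : z = ⟨R ψ, hz.1 ▸ z.2⟩ := Subtype.ext hz.1
    exact hz.2.symm.trans (congrArg X hz')

variable [CompleteSpace H]

theorem mem_graph_of_formal {T : H →ₗ.[ℂ] H} (hT : IsSelfAdjoint T) {x y : H}
    (h : ∀ w : T.domain, ⟪y, (w : H)⟫_ℂ = ⟪x, T w⟫_ℂ) : (x, y) ∈ T.graph := by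
  have hx : x ∈ T.adjoint.domain := T.mem_adjoint_domain_of_exists x ⟨y, h⟩
  have h2 : T.adjoint ⟨x, hx⟩ = y := LinearPMap.adjoint_apply_eq hT.dense_domain ⟨x, hx⟩ h
  have h3 : (x, y) ∈ T.adjoint.graph := by
    rw [← h2]; exact T.adjoint.mem_graph ⟨x, hx⟩
  rwa [LinearPMap.isSelfAdjoint_def.1 hT] at h3

theorem symm_of_mem_graph {T : H →ₗ.[ℂ] H} (hT : IsSelfAdjoint T) {x y x' y' : H}
    (h : (x, y) ∈ T.graph) (h' : (x', y') ∈ T.graph) : ⟪y, x'⟫_ℂ = ⟪x, y'⟫_ℂ := by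
  have h1 : (x, y) ∈ T.adjoint.graph := by rwa [LinearPMap.isSelfAdjoint_def.1 hT]
  obtain ⟨a, ha⟩ := (T.adjoint.mem_graph_iff').1 h1
  obtain ⟨b, hb⟩ := (T.mem_graph_iff').1 h'
  simp only [Prod.mk.injEq] at ha hb
  rw [← ha.1, ← ha.2, ← hb.1, ← hb.2]
  exact T.adjoint_isFormalAdjoint hT.dense_domain a b

theorem Commutes.adjoint {T : H →ₗ.[ℂ] H} (hT : IsSelfAdjoint T) {R : H →L[ℂ] H}
    (h : Commutes T R) : Commutes T (star R) := by
  rw [commutes_iff] at h ⊢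
  intro x y hxy
  refine mem_graph_of_formal hT fun w => ?_
  rw [ContinuousLinearMap.star_eq_adjoint, ContinuousLinearMap.adjoint_inner_left,
    ContinuousLinearMap.adjoint_inner_left]
  exact symm_of_mem_graph hT hxy (h _ _ (T.mem_graph w))

/-- The set `{T}'` of all bounded operators that commute with `T`, as a `*`-algebra. -/
def commutant (T : H →ₗ.[ℂ] H) (hT : IsSelfAdjoint T) : StarSubalgebra ℂ (H →L[ℂ] H) where
  carrier := {R | Commutes T R}
  mul_mem' {a b} ha hb := by
    simp only [Set.mem_ofPred_eq, commutes_iff] at ha hb ⊢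
    exact fun x y h => ha _ _ (hb _ _ h)
  add_mem' {a b} ha hb := by
    simp only [Set.mem_ofPred_eq, commutes_iff] at ha hb ⊢
    exact fun x y h => T.graph.add_mem (ha _ _ h) (hb _ _ h)
  algebraMap_mem' r := by
    simp only [Set.mem_ofPred_eq, commutes_iff]
    exact fun x y h => by simpa [Algebra.algebraMap_eq_smul_one] using T.graph.smul_mem r h
  star_mem' {a} ha := Commutes.adjoint hT ha

/-- The commutant of a `*`-subalgebra of `B(H)`. -/
def vnCommutant (A : StarSubalgebra ℂ (H →L[ℂ] H)) : VonNeumannAlgebra H where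
  toStarSubalgebra := StarSubalgebra.centralizer ℂ (A : Set (H →L[ℂ] H))
  centralizer_centralizer' := by simp

theorem coe_vnCommutant (A : StarSubalgebra ℂ (H →L[ℂ] H)) :
    (vnCommutant A : Set (H →L[ℂ] H)) = Set.centralizer (A : Set (H →L[ℂ] H)) := by
  have h : star (A : Set (H →L[ℂ] H)) = A := by
    ext x; simp
  change ((StarSubalgebra.centralizer ℂ (A : Set (H →L[ℂ] H)) : StarSubalgebra ℂ (H →L[ℂ] H)) :
    Set (H →L[ℂ] H)) = _
  rw [StarSubalgebra.coe_centralizer, h, Set.union_self]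

/-- The von Neumann algebra `W*(T) = {T}''`. -/
def wStar (T : H →ₗ.[ℂ] H) (hT : IsSelfAdjoint T) : VonNeumannAlgebra H :=
  vnCommutant (commutant T hT)

/-- The von Neumann algebra `W*(S) = C*(S)''` of a bounded operator `S`, where `C*(S)` is the unital
C*-algebra generated by `S`. -/
def wStarBounded (S : H →L[ℂ] H) : VonNeumannAlgebra H :=
  (vnCommutant (StarAlgebra.elemental ℂ S)).commutant

/-- A closed, densely defined operator `X` is affiliated with the von Neumann algebra `A` if it
commutes with all `R ∈ A'`. -/
structure Affiliated (X : H →ₗ.[ℂ] H) (A : VonNeumannAlgebra H) : Prop where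
  dense : Dense (X.domain : Set H)
  isClosed : X.IsClosed
  commutes : ∀ R ∈ A.commutant, Commutes X R

/-! The bounded transform -/

theorem exists_onePlusSq (T : H →ₗ.[ℂ] H) (hT : IsSelfAdjoint T) (x : H) :
    ∃ y z, (y, z) ∈ T.graph ∧ (z, x - y) ∈ T.graph := by
  let e := WithLp.linearEquiv 2 ℂ (H × H)
  let G : Submodule ℂ (WithLp 2 (H × H)) := T.graph.comap e.toLinearMap
  have hG : IsClosed (G : Set (WithLp 2 (H × H))) :=
    hT.isClosed.preimage (WithLp.prod_continuous_ofLp 2 H H)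
  have : CompleteSpace G := hG.completeSpace_coe
  let p := WithLp.toLp 2 (x, (0 : H))
  obtain ⟨q, hq, r, hr, hqr⟩ := G.exists_add_mem_mem_orthogonal p
  refine ⟨q.fst, q.snd, hq, mem_graph_of_formal hT fun w => ?_⟩
  have hw : WithLp.toLp 2 ((w : H), T w) ∈ G := T.mem_graph w
  have h0 := (Submodule.mem_orthogonal' G r).1 hr _ hw
  have h1 : r = p - q := by rw [hqr]; abel
  rw [h1] at h0
  simp only [WithLp.prod_inner_apply] at h0
  simp [p, inner_neg_left] at h0
  rw [add_neg_eq_zero] at h0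
  exact h0

theorem norm_sq_add_norm_sq {T : H →ₗ.[ℂ] H} (hT : IsSelfAdjoint T) {x y z : H}
    (h : (y, z) ∈ T.graph) (h' : (z, x - y) ∈ T.graph) :
    ‖y‖ ^ 2 + ‖z‖ ^ 2 = RCLike.re ⟪y, x⟫_ℂ := by
  have h1 := congrArg RCLike.re (symm_of_mem_graph hT h h')
  rw [inner_sub_right, map_sub, inner_self_eq_norm_sq, inner_self_eq_norm_sq] at h1
  linarith

theorem unique_onePlusSq {T : H →ₗ.[ℂ] H} (hT : IsSelfAdjoint T) {x y z y' z' : H}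
    (h₁ : (y, z) ∈ T.graph) (h₂ : (z, x - y) ∈ T.graph)
    (h₁' : (y', z') ∈ T.graph) (h₂' : (z', x - y') ∈ T.graph) : y = y' ∧ z = z' := by
  have h3 : (y - y', z - z') ∈ T.graph := T.graph.sub_mem h₁ h₁'
  have h4 : (z - z', (0 : H) - (y - y')) ∈ T.graph := by
    have := T.graph.sub_mem h₂ h₂'
    convert this using 1
    ext <;> simp
  have h5 := norm_sq_add_norm_sq hT h3 h4
  rw [inner_zero_right, map_zero] at h5
  constructor
  · rw [← sub_eq_zero, ← norm_eq_zero]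
    nlinarith [sq_nonneg ‖y - y'‖, sq_nonneg ‖z - z'‖]
  · rw [← sub_eq_zero, ← norm_eq_zero]
    nlinarith [sq_nonneg ‖y - y'‖, sq_nonneg ‖z - z'‖]

/-- The bounded operator `(1 + T²)⁻¹`: it maps `x` to the unique `y` in the domain of `T²` with
`y + T T y = x`. -/
def invOnePlusSq (T : H →ₗ.[ℂ] H) (hT : IsSelfAdjoint T) : H →L[ℂ] H :=
  LinearMap.mkContinuous
    { toFun := fun x => (exists_onePlusSq T hT x).choose
      map_add' := fun a b => by
        obtain ⟨za, ha, ha'⟩ := (exists_onePlusSq T hT a).choose_spec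
        obtain ⟨zb, hb, hb'⟩ := (exists_onePlusSq T hT b).choose_spec
        obtain ⟨zc, hc, hc'⟩ := (exists_onePlusSq T hT (a + b)).choose_spec
        refine (unique_onePlusSq hT hc hc' (T.graph.add_mem ha hb) ?_).1
        have := T.graph.add_mem ha' hb'
        convert this using 1
        ext
        · simp
        · simp only [Prod.mk_add_mk]; abel
      map_smul' := fun r a => by
        obtain ⟨za, ha, ha'⟩ := (exists_onePlusSq T hT a).choose_spec
        obtain ⟨zc, hc, hc'⟩ := (exists_onePlusSq T hT (r • a)).choose_spec
        refine (unique_onePlusSq hT hc hc' (T.graph.smul_mem r ha) ?_).1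
        have := T.graph.smul_mem r ha'
        convert this using 1
        ext
        · simp
        · simp [smul_sub] } 1
    (fun x => by
      obtain ⟨z, h, h'⟩ := (exists_onePlusSq T hT x).choose_spec
      have h1 := norm_sq_add_norm_sq hT h h'
      have h2 : RCLike.re ⟪(exists_onePlusSq T hT x).choose, x⟫_ℂ ≤ _ := re_inner_le_norm _ _
      simp only [LinearMap.coe_mk, AddHom.coe_mk, one_mul]
      by_contra hc
      push Not at hc
      nlinarith [sq_nonneg ‖z‖, norm_nonneg x, norm_nonneg (exists_onePlusSq T hT x).choose])

theorem invOnePlusSq_spec (T : H →ₗ.[ℂ] H) (hT : IsSelfAdjoint T) (x : H) :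
    ∃ z, (invOnePlusSq T hT x, z) ∈ T.graph ∧ (z, x - invOnePlusSq T hT x) ∈ T.graph :=
  (exists_onePlusSq T hT x).choose_spec

theorem invOnePlusSq_nonneg (T : H →ₗ.[ℂ] H) (hT : IsSelfAdjoint T) :
    0 ≤ invOnePlusSq T hT := by
  rw [ContinuousLinearMap.nonneg_iff_isPositive, ContinuousLinearMap.isPositive_def']
  constructor
  · rw [ContinuousLinearMap.isSelfAdjoint_iff_isSymmetric]
    intro a b
    obtain ⟨za, ha, ha'⟩ := invOnePlusSq_spec T hT a
    obtain ⟨zb, hb, hb'⟩ := invOnePlusSq_spec T hT b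
    have h1 := symm_of_mem_graph hT ha hb'
    have h2 := symm_of_mem_graph hT ha' hb
    rw [inner_sub_left] at h2
    rw [inner_sub_right] at h1
    have : ⟪invOnePlusSq T hT a, b⟫_ℂ = ⟪a, invOnePlusSq T hT b⟫_ℂ := by
      linear_combination -h1 - h2
    exact this
  · intro x
    obtain ⟨z, h, h'⟩ := invOnePlusSq_spec T hT x
    have h1 := norm_sq_add_norm_sq hT h h'
    rw [ContinuousLinearMap.reApplyInnerSelf_apply, ← h1]
    positivity

theorem isClosed_commutant (T : H →ₗ.[ℂ] H) (hT : IsSelfAdjoint T) :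
    IsClosed (commutant T hT : Set (H →L[ℂ] H)) := by
  have h : (commutant T hT : Set (H →L[ℂ] H)) =
      ⋂ p : T.graph, (fun R : H →L[ℂ] H => (R p.1.1, R p.1.2)) ⁻¹' (T.graph : Set (H × H)) := by
    ext R
    change Commutes T R ↔ _
    rw [commutes_iff]
    simp only [Set.mem_iInter, Set.mem_preimage, SetLike.mem_coe, Subtype.forall, Prod.forall]
  rw [h]
  exact isClosed_iInter fun p => hT.isClosed.preimage (by fun_prop)

theorem invOnePlusSq_mem_commutant (T : H →ₗ.[ℂ] H) (hT : IsSelfAdjoint T) :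
    invOnePlusSq T hT ∈ commutant T hT := by
  change Commutes T _
  rw [commutes_iff]
  intro x y hxy
  obtain ⟨z, h, h'⟩ := invOnePlusSq_spec T hT x
  obtain ⟨w, k, k'⟩ := invOnePlusSq_spec T hT y
  have h2 : (x - invOnePlusSq T hT x, y - z) ∈ T.graph := T.graph.sub_mem hxy h
  rw [← (unique_onePlusSq hT h' h2 k k').1]
  exact h

theorem sqrt_mem_commutant (T : H →ₗ.[ℂ] H) (hT : IsSelfAdjoint T) :
    CFC.sqrt (invOnePlusSq T hT) ∈ commutant T hT := by
  have h0 := invOnePlusSq_nonneg T hT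
  have : IsClosed (commutant T hT : Set (H →L[ℂ] H)) := isClosed_commutant T hT
  rw [CFC.sqrt_eq_real_sqrt _ h0, cfcₙ_eq_cfc]
  exact cfc_mem (𝕜' := ℂ) _ (invOnePlusSq_mem_commutant T hT)

theorem inner_sqrt (T : H →ₗ.[ℂ] H) (hT : IsSelfAdjoint T) (x y : H) :
    ⟪CFC.sqrt (invOnePlusSq T hT) x, y⟫_ℂ = ⟪x, CFC.sqrt (invOnePlusSq T hT) y⟫_ℂ := by
  have h : IsSelfAdjoint (CFC.sqrt (invOnePlusSq T hT)) :=
    IsSelfAdjoint.of_nonneg (CFC.sqrt_nonneg _)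
  exact (ContinuousLinearMap.isSelfAdjoint_iff_isSymmetric.1 h) x y

theorem sqrt_sqrt (T : H →ₗ.[ℂ] H) (hT : IsSelfAdjoint T) (x : H) :
    CFC.sqrt (invOnePlusSq T hT) (CFC.sqrt (invOnePlusSq T hT) x) = invOnePlusSq T hT x := by
  have h := CFC.sqrt_mul_sqrt_self _ (invOnePlusSq_nonneg T hT)
  exact congrArg (fun A : H →L[ℂ] H => A x) h

theorem denseRange_sqrt (T : H →ₗ.[ℂ] H) (hT : IsSelfAdjoint T) :
    DenseRange (fun x : H => CFC.sqrt (invOnePlusSq T hT) x) := by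
  set Q := CFC.sqrt (invOnePlusSq T hT) with hQ
  have h : (LinearMap.range Q.toLinearMap).topologicalClosure = ⊤ := by
    rw [Submodule.topologicalClosure_eq_top_iff, Submodule.eq_bot_iff]
    intro v hv
    have h1 : Q v = 0 := by
      rw [← inner_self_eq_zero (𝕜 := ℂ), hQ, inner_sqrt, ← hQ]
      exact (Submodule.mem_orthogonal' _ v).1 hv _ ⟨Q v, rfl⟩
    have h2 : invOnePlusSq T hT v = 0 := by rw [← sqrt_sqrt, ← hQ, h1, map_zero]
    obtain ⟨z, k, k'⟩ := invOnePlusSq_spec T hT v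
    rw [h2] at k k'
    have hz : z = 0 := T.graph_fst_eq_zero_snd k rfl
    rw [hz, sub_zero] at k'
    exact T.graph_fst_eq_zero_snd k' rfl
  rw [← Submodule.dense_iff_topologicalClosure_eq_top] at h
  exact h

theorem exists_boundedTransform (T : H →ₗ.[ℂ] H) (hT : IsSelfAdjoint T) :
    ∃ S : H →L[ℂ] H, ∀ x, (CFC.sqrt (invOnePlusSq T hT) x, S x) ∈ T.graph := by
  set Q := CFC.sqrt (invOnePlusSq T hT) with hQ
  have hdom : ∀ x, invOnePlusSq T hT x ∈ T.domain := fun x =>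
    T.mem_domain_of_mem_graph (invOnePlusSq_spec T hT x).choose_spec.1
  let f : H →ₗ[ℂ] H :=
    T.toFun ∘ₗ ((invOnePlusSq T hT).toLinearMap.codRestrict T.domain hdom)
  have hf : ∀ x, (invOnePlusSq T hT x, f x) ∈ T.graph := fun x => T.mem_graph ⟨_, hdom x⟩
  have hb : ∀ x, ‖f x‖ ≤ 1 * ‖Q.toLinearMap x‖ := by
    intro x
    obtain ⟨z, h, h'⟩ := invOnePlusSq_spec T hT x
    have hz : z = f x := T.mem_graph_snd_inj h (hf x) rfl
    have h1 := norm_sq_add_norm_sq hT h h'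
    have h2 : RCLike.re ⟪invOnePlusSq T hT x, x⟫_ℂ = ‖Q x‖ ^ 2 := by
      rw [← sqrt_sqrt, inner_sqrt, inner_self_eq_norm_sq]
    rw [h2, hz] at h1
    rw [one_mul]
    refine (sq_le_sq₀ (norm_nonneg _) (norm_nonneg _)).1 ?_
    have : ‖Q.toLinearMap x‖ = ‖Q x‖ := rfl
    rw [this]
    nlinarith [sq_nonneg ‖invOnePlusSq T hT x‖]
  refine ⟨f.extendOfNorm Q.toLinearMap, fun x => ?_⟩
  have hd : DenseRange Q.toLinearMap := denseRange_sqrt T hT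
  refine hd.induction_on (p := fun x => (Q x, f.extendOfNorm Q.toLinearMap x) ∈ T.graph) x ?_ ?_
  · exact hT.isClosed.preimage (by fun_prop)
  · intro a
    rw [LinearMap.extendOfNorm_eq hd ⟨1, hb⟩]
    have : Q (Q.toLinearMap a) = invOnePlusSq T hT a := sqrt_sqrt T hT a
    rw [this]
    exact hf a

theorem sqrt_mem_domain (T : H →ₗ.[ℂ] H) (hT : IsSelfAdjoint T) (x : H) :
    CFC.sqrt (invOnePlusSq T hT) x ∈ T.domain :=
  T.mem_domain_of_mem_graph ((exists_boundedTransform T hT).choose_spec x)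

/-- The bounded transform `S = T √((1 + T²)⁻¹)` of a self-adjoint operator `T`. -/
def boundedTransform (T : H →ₗ.[ℂ] H) (hT : IsSelfAdjoint T) : H →L[ℂ] H where
  toLinearMap := T.toFun ∘ₗ
    ((CFC.sqrt (invOnePlusSq T hT)).toLinearMap.codRestrict T.domain (sqrt_mem_domain T hT))
  cont := by
    obtain ⟨S, hS⟩ := exists_boundedTransform T hT
    convert S.continuous using 1
    funext x
    exact T.mem_graph_snd_inj (T.mem_graph ⟨_, sqrt_mem_domain T hT x⟩) (hS x) rfl

theorem boundedTransform_apply (T : H →ₗ.[ℂ] H) (hT : IsSelfAdjoint T) (x : H) :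
    boundedTransform T hT x =
      T ⟨CFC.sqrt (invOnePlusSq T hT) x, sqrt_mem_domain T hT x⟩ := rfl

theorem isSelfAdjoint_boundedTransform (T : H →ₗ.[ℂ] H) (hT : IsSelfAdjoint T) :
    IsSelfAdjoint (boundedTransform T hT) := by
  rw [ContinuousLinearMap.isSelfAdjoint_iff_isSymmetric]
  intro x y
  have hg : ∀ x, (CFC.sqrt (invOnePlusSq T hT) x, boundedTransform T hT x) ∈ T.graph :=
    fun x => T.mem_graph ⟨_, sqrt_mem_domain T hT x⟩
  refine hT.dense_domain.induction (P := fun y => ⟪boundedTransform T hT x, y⟫_ℂ =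
    ⟪x, boundedTransform T hT y⟫_ℂ) ?_ (isClosed_eq (by fun_prop) (by fun_prop)) y
  intro y hy
  have h1 := T.mem_graph ⟨y, hy⟩
  have h2 := commutes_iff.1 (sqrt_mem_commutant T hT) _ _ h1
  rw [symm_of_mem_graph hT (hg x) h1, inner_sqrt]
  congr 1
  exact T.mem_graph_snd_inj h2 (hg y) rfl

/-! The Borel functional calculus of a bounded normal operator -/

open scoped ComplexOrder in
/-- The positive functional `h ↦ ⟪x, h(S) x⟫` on the real continuous functions on `σ(S)`, for a
bounded normal operator `S`; here `h(S)` is the continuous functional calculus. -/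
def spectralFunctional {S : H →L[ℂ] H} (hS : IsStarNormal S) (x : H) :
    CompactlySupportedContinuousMap (spectrum ℂ S) ℝ →ₚ[ℝ] ℝ where
  toFun h := RCLike.re ⟪x, cfcHom hS (h.toContinuousMap.realToRCLike ℂ) x⟫_ℂ
  map_add' h k := by
    have : (h + k).toContinuousMap.realToRCLike ℂ =
      h.toContinuousMap.realToRCLike ℂ + k.toContinuousMap.realToRCLike ℂ := by ext; simp
    rw [this, map_add, add_apply, inner_add_right, map_add]
  map_smul' r h := by
    have : (r • h).toContinuousMap.realToRCLike ℂ =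
      (r : ℂ) • h.toContinuousMap.realToRCLike ℂ := by ext; simp
    rw [this, map_smul, smul_apply, inner_smul_right]
    simp
  monotone' h k hhk := by
    have h1 : h.toContinuousMap.realToRCLike ℂ ≤ k.toContinuousMap.realToRCLike ℂ :=
      ContinuousMap.realToRCLike_monotone _ ℂ hhk
    have h2 := cfcHom_mono hS h1
    rw [ContinuousLinearMap.le_def] at h2
    have h3 := h2.re_inner_nonneg_right x
    rw [sub_apply, inner_sub_right, map_sub] at h3
    change RCLike.re _ ≤ RCLike.re _
    linarith

/-- The spectral measure `μ_x` of a bounded normal operator `S` at the vector `x`: the regular Borel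
measure on `σ(S)` with `∫ h dμ_x = ⟪x, h(S) x⟫` for all continuous `h`. -/
def spectralMeasure {S : H →L[ℂ] H} (hS : IsStarNormal S) (x : H) : Measure (spectrum ℂ S) :=
  RealRMK.rieszMeasure (spectralFunctional hS x)

instance {S : H →L[ℂ] H} (hS : IsStarNormal S) (x : H) :
    IsFiniteMeasure (spectralMeasure hS x) := by
  unfold spectralMeasure; infer_instance

theorem integral_real_spectralMeasure {S : H →L[ℂ] H} (hS : IsStarNormal S) (x : H)
    (h : C(spectrum ℂ S, ℝ)) :
    ∫ t, h t ∂(spectralMeasure hS x) = RCLike.re ⟪x, cfcHom hS (h.realToRCLike ℂ) x⟫_ℂ :=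
  RealRMK.integral_rieszMeasure (spectralFunctional hS x)
    ⟨h, HasCompactSupport.of_compactSpace _⟩

theorem integral_spectralMeasure {S : H →L[ℂ] H} (hS : IsStarNormal S) (x : H)
    (h : C(spectrum ℂ S, ℂ)) :
    ∫ t, h t ∂(spectralMeasure hS x) = ⟪x, cfcHom hS h x⟫_ℂ := by
  have key : ∀ k : C(spectrum ℂ S, ℝ), ⟪x, cfcHom hS (k.realToRCLike ℂ) x⟫_ℂ =
      ((∫ t, k t ∂(spectralMeasure hS x) : ℝ) : ℂ) := by
    intro k
    rw [integral_real_spectralMeasure]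
    have h1 : IsSelfAdjoint (cfcHom hS (k.realToRCLike ℂ)) :=
      (ContinuousMap.isSelfAdjoint_realToRCLike ℂ).map _
    have h2 := (ContinuousLinearMap.isSelfAdjoint_iff_isSymmetric.1 h1).coe_re_inner_self_apply x
    exact h2.symm
  let a : C(spectrum ℂ S, ℝ) := ⟨fun t => (h t).re, by fun_prop⟩
  let b : C(spectrum ℂ S, ℝ) := ⟨fun t => (h t).im, by fun_prop⟩
  have hab : h = a.realToRCLike ℂ + Complex.I • b.realToRCLike ℂ := by
    ext t
    simp [a, b, mul_comm Complex.I, Complex.re_add_im]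
  have hi : Integrable (fun t => h t) (spectralMeasure hS x) :=
    h.continuous.integrable_of_hasCompactSupport (HasCompactSupport.of_compactSpace _)
  conv_rhs => rw [hab, map_add, map_smul, add_apply,
    smul_apply, inner_add_right, inner_smul_right, key, key]
  have h1 := integral_re_add_im hi
  rw [← h1]
  simp [a, b, mul_comm Complex.I]

theorem norm_cfcHom_apply {S : H →L[ℂ] H} (hS : IsStarNormal S) (x : H)
    (h : C(spectrum ℂ S, ℂ)) :
    ‖cfcHom hS h x‖ = ‖ContinuousMap.toLp 2 (spectralMeasure hS x) ℂ h‖ := by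
  rw [← sq_eq_sq₀ (norm_nonneg _) (norm_nonneg _), ← inner_self_eq_norm_sq (𝕜 := ℂ),
    ← inner_self_eq_norm_sq (𝕜 := ℂ), ContinuousMap.inner_toLp]
  have h1 := integral_spectralMeasure hS x (h * star h)
  have h2 : ⟪x, cfcHom hS (h * star h) x⟫_ℂ = ⟪cfcHom hS h x, cfcHom hS h x⟫_ℂ := by
    rw [mul_comm, map_mul, map_star, mul_apply_eq_comp,
      ContinuousLinearMap.star_eq_adjoint, ContinuousLinearMap.adjoint_inner_right]
  rw [h2] at h1
  rw [← h1]
  rfl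

theorem spectralMeasure_ext {S : H →L[ℂ] H} (hS : IsStarNormal S) {x : H}
    {ν : Measure (spectrum ℂ S)} [IsFiniteMeasure ν]
    (h : ∀ k : C(spectrum ℂ S, ℝ), RCLike.re ⟪x, cfcHom hS (k.realToRCLike ℂ) x⟫_ℂ = ∫ t, k t ∂ν) :
    spectralMeasure hS x = ν := by
  refine ext_of_forall_integral_eq_of_IsFiniteMeasure fun f => ?_
  have h1 := h f.toContinuousMap
  rw [← integral_real_spectralMeasure] at h1
  exact h1

theorem integrable_continuous {X : Type*} [TopologicalSpace X] [CompactSpace X]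
    [MeasurableSpace X] [BorelSpace X] (ν : Measure X) [IsFiniteMeasure ν] (k : C(X, ℝ)) :
    Integrable (fun t => k t) ν :=
  k.continuous.integrable_of_hasCompactSupport (HasCompactSupport.of_compactSpace _)

theorem spectralMeasure_zero {S : H →L[ℂ] H} (hS : IsStarNormal S) :
    spectralMeasure hS 0 = 0 :=
  spectralMeasure_ext hS fun k => by simp

theorem spectralMeasure_smul {S : H →L[ℂ] H} (hS : IsStarNormal S) (c : ℂ) (x : H) :
    spectralMeasure hS (c • x) = (‖c‖₊ ^ 2) • spectralMeasure hS x := by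
  refine spectralMeasure_ext hS fun k => ?_
  rw [integral_smul_nnreal_measure, integral_real_spectralMeasure, map_smul, inner_smul_left,
    inner_smul_right, ← mul_assoc, RCLike.conj_mul]
  rw [← RCLike.ofReal_pow, RCLike.re_ofReal_mul]
  rfl

theorem spectralMeasure_add_add_sub {S : H →L[ℂ] H} (hS : IsStarNormal S) (x y : H) :
    spectralMeasure hS (x + y) + spectralMeasure hS (x - y) =
      (2 : NNReal) • (spectralMeasure hS x + spectralMeasure hS y) := by
  refine ext_of_forall_integral_eq_of_IsFiniteMeasure fun f => ?_
  let k : C(spectrum ℂ S, ℝ) := f.toContinuousMap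
  change ∫ t, k t ∂_ = ∫ t, k t ∂_
  rw [integral_smul_nnreal_measure, integral_add_measure (integrable_continuous _ k)
    (integrable_continuous _ k), integral_add_measure (integrable_continuous _ k)
    (integrable_continuous _ k)]
  simp only [integral_real_spectralMeasure, map_add, map_sub, inner_add_left, inner_add_right,
    inner_sub_left, inner_sub_right]
  rw [NNReal.smul_def]
  simp only [smul_eq_mul, NNReal.coe_ofNat]
  ring

theorem spectralMeasure_add_le {S : H →L[ℂ] H} (hS : IsStarNormal S) (x y : H) :
    spectralMeasure hS (x + y) ≤ (2 : NNReal) • (spectralMeasure hS x + spectralMeasure hS y) := by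
  rw [← spectralMeasure_add_add_sub]
  exact Measure.le_add_right le_rfl

theorem memLp_add_measure {X : Type*} [MeasurableSpace X] {μ ν : Measure X} {g : X → ℂ}
    (h : MemLp g 2 μ) (h' : MemLp g 2 ν) : MemLp g 2 (μ + ν) := by
  refine ⟨h.1.add_measure h'.1, ?_⟩
  have h1 := h.2
  have h2 := h'.2
  rw [eLpNorm_lt_top_iff_lintegral_rpow_enorm_lt_top (by simp) (by simp)] at h1 h2 ⊢
  rw [lintegral_add_measure]
  exact ENNReal.add_lt_top.2 ⟨h1, h2⟩

theorem memLp_spectralMeasure_add {S : H →L[ℂ] H} (hS : IsStarNormal S) {x y : H}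
    {g : spectrum ℂ S → ℂ} (hx : MemLp g 2 (spectralMeasure hS x))
    (hy : MemLp g 2 (spectralMeasure hS y)) : MemLp g 2 (spectralMeasure hS (x + y)) := by
  have h1 := (memLp_add_measure hx hy).smul_measure (c := (2 : ℝ≥0∞)) (by simp)
  exact h1.mono_measure (spectralMeasure_add_le hS x y)

/-- The isometry `V_x : L²(σ(S), μ_x) → H` that extends `h ↦ h(S) x`, `h` continuous. -/
def cyclicMap {S : H →L[ℂ] H} (hS : IsStarNormal S) (x : H) :
    Lp ℂ 2 (spectralMeasure hS x) →L[ℂ] H :=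
  LinearMap.extendOfNorm
    ({ toFun := fun h => cfcHom hS h x
       map_add' := fun a b => by rw [map_add, add_apply]
       map_smul' := fun c a => by
         rw [map_smul, smul_apply, RingHom.id_apply] } :
      C(spectrum ℂ S, ℂ) →ₗ[ℂ] H)
    (ContinuousMap.toLp 2 (spectralMeasure hS x) ℂ : C(spectrum ℂ S, ℂ) →L[ℂ] _).toLinearMap

theorem denseRange_toLp {S : H →L[ℂ] H} (hS : IsStarNormal S) (x : H) :
    DenseRange (ContinuousMap.toLp 2 (spectralMeasure hS x) ℂ : C(spectrum ℂ S, ℂ) →L[ℂ] _) :=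
  ContinuousMap.toLp_denseRange ℂ _ ℂ (by simp)

theorem cyclicMap_toLp {S : H →L[ℂ] H} (hS : IsStarNormal S) (x : H) (h : C(spectrum ℂ S, ℂ)) :
    cyclicMap hS x (ContinuousMap.toLp 2 (spectralMeasure hS x) ℂ h) = cfcHom hS h x :=
  LinearMap.extendOfNorm_eq (denseRange_toLp hS x)
    ⟨1, fun h => by rw [one_mul]; exact (norm_cfcHom_apply hS x h).le⟩ h

theorem norm_cyclicMap {S : H →L[ℂ] H} (hS : IsStarNormal S) (x : H)
    (u : Lp ℂ 2 (spectralMeasure hS x)) : ‖cyclicMap hS x u‖ = ‖u‖ := by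
  refine (denseRange_toLp hS x).induction_on (p := fun u => ‖cyclicMap hS x u‖ = ‖u‖) u
    (isClosed_eq (by fun_prop) (by fun_prop)) fun h => ?_
  rw [cyclicMap_toLp, norm_cfcHom_apply]

theorem norm_cyclicMap_sub {S : H →L[ℂ] H} (hS : IsStarNormal S) (x : H)
    {g : spectrum ℂ S → ℂ} (hg : MemLp g 2 (spectralMeasure hS x)) (h : C(spectrum ℂ S, ℂ)) :
    ‖cyclicMap hS x (hg.toLp g) - cfcHom hS h x‖ =
      (eLpNorm (g - (⇑h)) 2 (spectralMeasure hS x)).toReal := by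
  have hh : MemLp (h : spectrum ℂ S → ℂ) 2 (spectralMeasure hS x) := by
    exact MemLp.of_bound h.continuous.aestronglyMeasurable ‖h‖ (ae_of_all _ h.norm_coe_le_norm)
  have h1 : ContinuousMap.toLp 2 (spectralMeasure hS x) ℂ h = hh.toLp h := rfl
  rw [← cyclicMap_toLp, ← map_sub, norm_cyclicMap, h1, ← MemLp.toLp_sub, Lp.norm_toLp]

theorem exists_approx {X : Type*} [TopologicalSpace X] [MeasurableSpace X] [BorelSpace X]
    [TopologicalSpace.PseudoMetrizableSpace X] (μ ν ρ : Measure X) [IsFiniteMeasure μ]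
    [IsFiniteMeasure ν] [IsFiniteMeasure ρ] {g : X → ℂ} (h₁ : MemLp g 2 μ) (h₂ : MemLp g 2 ν)
    (h₃ : MemLp g 2 ρ) {ε : ℝ} (hε : 0 < ε) :
    ∃ h : C(X, ℂ), (eLpNorm (g - (⇑h)) 2 μ).toReal ≤ ε ∧ (eLpNorm (g - (⇑h)) 2 ν).toReal ≤ ε ∧
      (eLpNorm (g - (⇑h)) 2 ρ).toReal ≤ ε := by
  have h4 := memLp_add_measure (memLp_add_measure h₁ h₂) h₃
  obtain ⟨k, hk, -⟩ := h4.exists_boundedContinuous_eLpNorm_sub_le (by simp)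
    (ENNReal.ofReal_pos.2 hε).ne'
  refine ⟨k.toContinuousMap, ?_, ?_, ?_⟩ <;>
  refine ENNReal.toReal_le_of_le_ofReal hε.le ((eLpNorm_mono_measure _ ?_).trans hk)
  · exact (Measure.le_add_right le_rfl).trans (Measure.le_add_right le_rfl)
  · exact (Measure.le_add_left le_rfl).trans (Measure.le_add_right le_rfl)
  · exact Measure.le_add_left le_rfl

theorem cyclicMap_add {S : H →L[ℂ] H} (hS : IsStarNormal S) {x y : H} {g : spectrum ℂ S → ℂ}
    (hx : MemLp g 2 (spectralMeasure hS x)) (hy : MemLp g 2 (spectralMeasure hS y))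
    (hxy : MemLp g 2 (spectralMeasure hS (x + y))) :
    cyclicMap hS (x + y) (hxy.toLp g) =
      cyclicMap hS x (hx.toLp g) + cyclicMap hS y (hy.toLp g) := by
  refine eq_of_forall_dist_le fun ε hε => ?_
  obtain ⟨h, h1, h2, h3⟩ := exists_approx _ _ _ hx hy hxy (show (0 : ℝ) < ε / 3 by positivity)
  rw [← norm_cyclicMap_sub hS x hx] at h1
  rw [← norm_cyclicMap_sub hS y hy] at h2
  rw [← norm_cyclicMap_sub hS (x + y) hxy] at h3
  rw [map_add] at h3
  rw [dist_eq_norm]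
  calc _ = ‖(cyclicMap hS (x + y) (hxy.toLp g) - (cfcHom hS h x + cfcHom hS h y)) -
        (cyclicMap hS x (hx.toLp g) - cfcHom hS h x) -
        (cyclicMap hS y (hy.toLp g) - cfcHom hS h y)‖ := by
        congr 1; abel
    _ ≤ ε / 3 + ε / 3 + ε / 3 :=
        (norm_sub_le _ _).trans (add_le_add ((norm_sub_le _ _).trans (add_le_add h3 h1)) h2)
    _ = ε := by ring

theorem cyclicMap_smul {S : H →L[ℂ] H} (hS : IsStarNormal S) (c : ℂ) {x : H}
    {g : spectrum ℂ S → ℂ} (hx : MemLp g 2 (spectralMeasure hS x))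
    (hcx : MemLp g 2 (spectralMeasure hS (c • x))) :
    cyclicMap hS (c • x) (hcx.toLp g) = c • cyclicMap hS x (hx.toLp g) := by
  refine eq_of_forall_dist_le fun ε hε => ?_
  obtain ⟨h, h1, -, h3⟩ := exists_approx _ _ _ hx hx hcx
    (show (0 : ℝ) < ε / (1 + ‖c‖) by positivity)
  rw [← norm_cyclicMap_sub hS x hx] at h1
  rw [← norm_cyclicMap_sub hS (c • x) hcx] at h3
  rw [map_smul] at h3
  rw [dist_eq_norm]
  calc _ = ‖(cyclicMap hS (c • x) (hcx.toLp g) - c • cfcHom hS h x) -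
        c • (cyclicMap hS x (hx.toLp g) - cfcHom hS h x)‖ := by
        congr 1; rw [smul_sub]; abel
    _ ≤ ε / (1 + ‖c‖) + ‖c‖ * (ε / (1 + ‖c‖)) := by
        refine (norm_sub_le _ _).trans (add_le_add h3 ?_)
        rw [norm_smul]
        gcongr
    _ = ε := by field_simp

/-- The Borel functional calculus `g(S)` of a bounded normal operator `S`, for an arbitrary
(possibly unbounded) Borel function `g` on `σ(S)`: its domain is
`{x | ∫ |g|² dμ_x < ∞}`, and `g(S) x = V_x g`, i.e. `g(S) x` is the limit of `hₙ(S) x` for every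
sequence of continuous functions `hₙ` that converges to `g` in `L²(μ_x)`. -/
def borelCalculus {S : H →L[ℂ] H} (hS : IsStarNormal S) (g : spectrum ℂ S → ℂ) :
    H →ₗ.[ℂ] H where
  domain :=
    { carrier := {x | MemLp g 2 (spectralMeasure hS x)}
      zero_mem' := by
        change MemLp g 2 (spectralMeasure hS 0)
        rw [spectralMeasure_zero]
        exact memLp_measure_zero
      add_mem' := fun hx hy => memLp_spectralMeasure_add hS hx hy
      smul_mem' := fun c x hx => by
        change MemLp g 2 (spectralMeasure hS (c • x))
        rw [spectralMeasure_smul]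
        exact hx.smul_measure (c := ((‖c‖₊ ^ 2 : NNReal) : ℝ≥0∞)) (by simp) }
  toFun :=
    { toFun := fun x => cyclicMap hS x (MemLp.toLp g x.2)
      map_add' := fun x y => cyclicMap_add hS x.2 y.2 (x + y).2
      map_smul' := fun c x => cyclicMap_smul hS c x.2 (c • x).2 }

theorem mem_domain_borelCalculus {S : H →L[ℂ] H} (hS : IsStarNormal S) (g : spectrum ℂ S → ℂ)
    (x : H) : x ∈ (borelCalculus hS g).domain ↔ MemLp g 2 (spectralMeasure hS x) := Iff.rfl

/-- The values of the Borel functional calculus satisfy `⟪x, g(S) x⟫ = ∫ g dμ_x`. -/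
theorem inner_borelCalculus {S : H →L[ℂ] H} (hS : IsStarNormal S) (g : spectrum ℂ S → ℂ)
    (x : (borelCalculus hS g).domain) :
    ⟪(x : H), borelCalculus hS g x⟫_ℂ = ∫ t, g t ∂(spectralMeasure hS (x : H)) := by
  have key : ∀ u : Lp ℂ 2 (spectralMeasure hS (x : H)), ⟪(x : H), cyclicMap hS (x : H) u⟫_ℂ =
      ⟪indicatorConstLp 2 MeasurableSet.univ (measure_ne_top (spectralMeasure hS (x : H)) _)
        (1 : ℂ), u⟫_ℂ := by
    intro u
    refine (denseRange_toLp hS x).induction_on (p := fun u => ⟪(x : H), cyclicMap hS (x : H) u⟫_ℂ =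
      ⟪indicatorConstLp 2 MeasurableSet.univ (measure_ne_top (spectralMeasure hS (x : H)) _)
        (1 : ℂ), u⟫_ℂ) u (isClosed_eq (by fun_prop) (by fun_prop)) fun h => ?_
    rw [cyclicMap_toLp, L2.inner_indicatorConstLp_one, setIntegral_univ,
      ← integral_spectralMeasure]
    exact integral_congr_ae (ContinuousMap.coeFn_toLp _ h).symm
  have h1 := key (MemLp.toLp g x.2)
  rw [L2.inner_indicatorConstLp_one, setIntegral_univ] at h1
  refine Eq.trans h1 ?_
  exact integral_congr_ae (MemLp.coeFn_toLp x.2)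

/-! Functions of an unbounded self-adjoint operator -/

/-- The function `u : (-1, 1) → ℝ`, `u(x) = x / √(1 - x²)`. -/
def u (x : ℝ) : ℝ := x / √(1 - x ^ 2)

open scoped Classical in
/-- The function `f ∘ u` on `σ(S)`, for a function `f` on `σ(T)`. It is defined by `f(u(x))` at the
points `x` of `σ(S) ∩ (-1, 1)`, which `u` maps to `σ(T)`, and by `0` at the points `±1`, if these
lie in `σ(S)` (they are not eigenvalues of `S`, so that the value chosen there is irrelevant). -/
def compU (T : H →ₗ.[ℂ] H) (hT : IsSelfAdjoint T) (f : opSpectrum T → ℂ) :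
    spectrum ℂ (boundedTransform T hT) → ℂ := fun x =>
  if h : (x : ℂ).re ∈ Set.Ioo (-1 : ℝ) 1 ∧ ((u (x : ℂ).re : ℝ) : ℂ) ∈ opSpectrum T then f ⟨_, h.2⟩
  else 0

/-- The operator `f(T) = (f ∘ u)(S)`. -/
def borelFunction (T : H →ₗ.[ℂ] H) (hT : IsSelfAdjoint T) (f : opSpectrum T → ℂ) : H →ₗ.[ℂ] H :=
  borelCalculus (isSelfAdjoint_boundedTransform T hT).isStarNormal (compU T hT f)

/-- The `*`-algebra `B_b(X)` of bounded Borel functions on `X ⊆ ℂ`. -/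
def boundedBorel (X : Set ℂ) : StarSubalgebra ℂ (X → ℂ) where
  carrier := {f | Measurable f ∧ ∃ C : ℝ, ∀ x, ‖f x‖ ≤ C}
  mul_mem' := by
    rintro f g ⟨hf, C, hC⟩ ⟨hg, D, hD⟩
    exact ⟨hf.mul hg, C * D, fun x => (norm_mul_le _ _).trans
      (mul_le_mul (hC x) (hD x) (norm_nonneg _) ((norm_nonneg _).trans (hC x)))⟩
  add_mem' := by
    rintro f g ⟨hf, C, hC⟩ ⟨hg, D, hD⟩
    exact ⟨hf.add hg, C + D, fun x => (norm_add_le _ _).trans (add_le_add (hC x) (hD x))⟩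
  algebraMap_mem' := fun r => ⟨measurable_const, ‖r‖, fun _ => le_rfl⟩
  star_mem' := by
    rintro f ⟨hf, C, hC⟩
    exact ⟨Complex.continuous_conj.measurable.comp hf, C, fun x => by
      simpa using hC x⟩

end BoundedTransform

end

noncomputable section

open MeasureTheory
open scoped InnerProductSpace ENNReal

namespace BoundedTransform

variable {H : Type*} [NormedAddCommGroup H] [InnerProductSpace ℂ H] [CompleteSpace H]

open Filter Topology

/-! Limits and products in the Borel functional calculus of a bounded normal operator -/

/-! Write Q = √((1 + T²)⁻¹). Then TQ = S and S² = 1 - Q², and everything about T is transferred to S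
through these two identities.

The domain of T is the range of Q, because x = Q(Qx + STx) for x in the domain
(`eq_sqrt_of_mem_graph`). So T is the map Qz ↦ Sz. A bounded R that commutes with T or with S
commutes with Q², hence with Q, hence with the other of the two (`commutes_iff_commute`). This gives
{T}' = C*(S)', and W*(T) = W*(S) on passing to commutants.

For the calculus of S, each vector x carries the isometry V_x from L²(μ_x), and the spectral measure
of V_x k is |k|²μ_x (`spectralMeasure_cyclicMap`). Multiplicativity follows from this; adjoints and
commutation follow by approximating g with continuous functions in two spectral measures at once.
For unbounded g let 1_m be the indicator of {|g| ≤ m}. A pair (x, y) is in the graph of g(S) exactly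
when (g 1_m)(S)x = 1_m(S)y for all m (`mem_graph_borelCalculus_iff`). The graph is thus cut out by
bounded operators, which gives closedness and commutation; density of the domain comes from 1_m(S)x
→ x.

Two facts lead back to functions of T. The function u maps σ(S) ∩ (-1, 1) into σ(T)
(`u_mem_opSpectrum`), so the default value 0 of f ∘ u occurs only at ±1. The points ±1 are null for
every μ_x, since 1 - S² = (1 + T²)⁻¹ is injective (`ae_sq_ne_one`). Together they make f ↦ f(T)
unital. -/

theorem exists_seq_approx {X : Type*} [TopologicalSpace X] [MeasurableSpace X] [BorelSpace X]
    [TopologicalSpace.PseudoMetrizableSpace X] (μ ν : Measure X) [IsFiniteMeasure μ]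
    [IsFiniteMeasure ν] {g : X → ℂ} (h₁ : MemLp g 2 μ) (h₂ : MemLp g 2 ν) :
    ∃ h : ℕ → C(X, ℂ), Tendsto (fun n => (eLpNorm (g - (⇑(h n))) 2 μ).toReal) atTop (𝓝 0) ∧
      Tendsto (fun n => (eLpNorm (g - (⇑(h n))) 2 ν).toReal) atTop (𝓝 0) := by
  choose h hμ hν _ using fun n : ℕ => exists_approx μ ν ν h₁ h₂ h₂ (Nat.one_div_pos_of_nat (n := n))
  exact ⟨h, squeeze_zero (fun _ => ENNReal.toReal_nonneg) hμ tendsto_one_div_add_atTop_nhds_zero_nat,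
    squeeze_zero (fun _ => ENNReal.toReal_nonneg) hν tendsto_one_div_add_atTop_nhds_zero_nat⟩

theorem memLp_continuous {X : Type*} [TopologicalSpace X] [CompactSpace X]
    [MeasurableSpace X] [BorelSpace X] (ν : Measure X) [IsFiniteMeasure ν] (k : C(X, ℂ)) :
    MemLp (⇑k) 2 ν :=
  MemLp.of_bound k.continuous.aestronglyMeasurable ‖k‖ (ae_of_all _ k.norm_coe_le_norm)

section

variable {S : H →L[ℂ] H} (hS : IsStarNormal S)

theorem tendsto_cfcHom {x : H} {g : spectrum ℂ S → ℂ} (hg : MemLp g 2 (spectralMeasure hS x))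
    {h : ℕ → C(spectrum ℂ S, ℂ)}
    (hh : Tendsto (fun n => (eLpNorm (g - (⇑(h n))) 2 (spectralMeasure hS x)).toReal) atTop (𝓝 0)) :
    Tendsto (fun n => cfcHom hS (h n) x) atTop (𝓝 (cyclicMap hS x (hg.toLp g))) := by
  rw [tendsto_iff_norm_sub_tendsto_zero]
  refine hh.congr fun n => ?_
  rw [norm_sub_rev, norm_cyclicMap_sub]

theorem tendsto_cyclicMap {x : H} {g : ℕ → spectrum ℂ S → ℂ} {k : spectrum ℂ S → ℂ}
    (hg : ∀ n, MemLp (g n) 2 (spectralMeasure hS x)) (hk : MemLp k 2 (spectralMeasure hS x))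
    (h : Tendsto (fun n => eLpNorm (g n - k) 2 (spectralMeasure hS x)) atTop (𝓝 0)) :
    Tendsto (fun n => cyclicMap hS x ((hg n).toLp (g n))) atTop
      (𝓝 (cyclicMap hS x (hk.toLp k))) :=
  ((cyclicMap hS x).continuous.tendsto _).comp ((Lp.tendsto_Lp_iff_tendsto_eLpNorm'' g hg k hk).2 h)

theorem cyclicMap_continuous (x : H) (h : C(spectrum ℂ S, ℂ))
    (hh : MemLp (⇑h) 2 (spectralMeasure hS x)) :
    cyclicMap hS x (hh.toLp h) = cfcHom hS h x :=
  cyclicMap_toLp hS x h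

theorem cyclicMap_one (x : H) (h : MemLp (1 : spectrum ℂ S → ℂ) 2 (spectralMeasure hS x)) :
    cyclicMap hS x (h.toLp 1) = x := by
  have h1 := cyclicMap_continuous hS x (1 : C(spectrum ℂ S, ℂ)) h
  rw [map_one] at h1
  exact h1

theorem inner_cyclicMap (x : H) (a b : Lp ℂ 2 (spectralMeasure hS x)) :
    ⟪cyclicMap hS x a, cyclicMap hS x b⟫_ℂ = ⟪a, b⟫_ℂ :=
  (LinearMap.norm_map_iff_inner_map_map (cyclicMap hS x)).1 (norm_cyclicMap hS x) a b

/-- Multiplicativity with a continuous left factor: it holds for continuous k, and multiplication by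
h is bounded on L² with bound ‖h‖, so it survives the L² limit. -/
theorem cfcHom_cyclicMap {x : H} {k : spectrum ℂ S → ℂ} (h : C(spectrum ℂ S, ℂ))
    (hk : MemLp k 2 (spectralMeasure hS x)) (hhk : MemLp (⇑h * k) 2 (spectralMeasure hS x)) :
    cfcHom hS h (cyclicMap hS x (hk.toLp k)) = cyclicMap hS x (hhk.toLp (⇑h * k)) := by
  obtain ⟨a, ha, -⟩ := exists_seq_approx _ _ hk hk
  refine tendsto_nhds_unique
    (((cfcHom hS h).continuous.tendsto _).comp (tendsto_cfcHom hS hk ha)) ?_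
  have h1 : ∀ n, cfcHom hS h (cfcHom hS (a n) x) = cfcHom hS (h * a n) x := fun n => by
    rw [map_mul]; rfl
  simp only [Function.comp_def, h1]
  refine tendsto_cfcHom hS hhk (squeeze_zero (fun _ => ENNReal.toReal_nonneg) (fun n => ?_)
    (by simpa using ha.const_mul ‖h‖))
  rw [← ENNReal.toReal_ofReal (norm_nonneg h), ← ENNReal.toReal_mul]
  refine ENNReal.toReal_mono
    (ENNReal.mul_ne_top ENNReal.ofReal_ne_top (hk.sub (memLp_continuous _ (a n))).2.ne) ?_
  refine eLpNorm_le_mul_eLpNorm_of_ae_le_mul (ae_of_all _ fun t => ?_) 2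
  simp only [Pi.sub_apply, Pi.mul_apply, ContinuousMap.coe_mul, ← mul_sub, norm_mul]
  gcongr
  exact h.norm_coe_le_norm t

theorem memLp_continuous_mul {x : H} {k : spectrum ℂ S → ℂ} (h : C(spectrum ℂ S, ℂ))
    (hk : MemLp k 2 (spectralMeasure hS x)) : MemLp (⇑h * k) 2 (spectralMeasure hS x) :=
  hk.mul (MemLp.of_bound h.continuous.aestronglyMeasurable ‖h‖
    (ae_of_all _ h.norm_coe_le_norm) : MemLp (⇑h) ∞ (spectralMeasure hS x))

theorem lintegral_enorm_sq_ne_top {X : Type*} [MeasurableSpace X] {μ : Measure X} {k : X → ℂ}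
    (hk : MemLp k 2 μ) : ∫⁻ t, ‖k t‖ₑ ^ 2 ∂μ ≠ ∞ := by
  have h := hk.2
  rw [eLpNorm_lt_top_iff_lintegral_rpow_enorm_lt_top (by simp) (by simp)] at h
  simpa using h.ne

theorem eLpNorm_withDensity_enorm_sq {X : Type*} [MeasurableSpace X] (μ : Measure X) {k : X → ℂ}
    (hk : Measurable k) (g : X → ℂ) :
    eLpNorm g 2 (μ.withDensity fun t => ‖k t‖ₑ ^ 2) = eLpNorm (g * k) 2 μ := by
  rw [eLpNorm_eq_lintegral_rpow_enorm_toReal (by simp) (by simp),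
    eLpNorm_eq_lintegral_rpow_enorm_toReal (by simp) (by simp),
    lintegral_withDensity_eq_lintegral_mul_non_measurable _ (by fun_prop)
      (ae_of_all _ fun t => by simp)]
  congr 1
  refine lintegral_congr fun t => ?_
  simp [enorm_mul, mul_pow, mul_comm]

/-- Since V_x is isometric and intertwines multiplication by h with h(S), ⟪V_x k, h(S) V_x k⟫ = ∫ h
|k|² dμ_x for continuous h, and these integrals determine a finite measure. -/
theorem spectralMeasure_cyclicMap {x : H} {k : spectrum ℂ S → ℂ} (hkm : Measurable k)
    (hk : MemLp k 2 (spectralMeasure hS x)) :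
    spectralMeasure hS (cyclicMap hS x (hk.toLp k)) =
      (spectralMeasure hS x).withDensity fun t => ‖k t‖ₑ ^ 2 := by
  have := isFiniteMeasure_withDensity (lintegral_enorm_sq_ne_top hk)
  refine spectralMeasure_ext hS fun h => ?_
  have hhk := memLp_continuous_mul hS (h.realToRCLike ℂ) hk
  rw [cfcHom_cyclicMap hS _ hk hhk, inner_cyclicMap, L2.inner_def,
    integral_withDensity_eq_integral_toReal_smul (by fun_prop) (ae_of_all _ fun t => by simp)]
  have h1 : ∫ t, ⟪hk.toLp k t, hhk.toLp _ t⟫_ℂ ∂(spectralMeasure hS x) =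
      ((∫ t, (‖k t‖ₑ ^ 2).toReal • h t ∂(spectralMeasure hS x) : ℝ) : ℂ) := by
    rw [← integral_complex_ofReal]
    refine integral_congr_ae ?_
    filter_upwards [hk.coeFn_toLp, hhk.coeFn_toLp] with t h1 h2
    rw [h1, h2]
    simp [mul_assoc, Complex.mul_conj']
    ring
  rw [h1]
  exact Complex.ofReal_re _

theorem memLp_mul_of_memLp_spectralMeasure {x : H} {g k : spectrum ℂ S → ℂ} (hgm : Measurable g)
    (hkm : Measurable k) (hk : MemLp k 2 (spectralMeasure hS x)) :
    MemLp g 2 (spectralMeasure hS (cyclicMap hS x (hk.toLp k))) ↔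
      MemLp (g * k) 2 (spectralMeasure hS x) := by
  rw [spectralMeasure_cyclicMap hS hkm]
  constructor
  · exact fun h => ⟨(hgm.mul hkm).aestronglyMeasurable, by
      rw [← eLpNorm_withDensity_enorm_sq _ hkm]; exact h.2⟩
  · exact fun h => ⟨hgm.aestronglyMeasurable, by
      rw [eLpNorm_withDensity_enorm_sq _ hkm]; exact h.2⟩

/-- Multiplicativity: `g(S) (k(S) x) = (g k)(S) x`. -/
theorem cyclicMap_cyclicMap {x : H} {g k : spectrum ℂ S → ℂ}
    (hkm : Measurable k) (hk : MemLp k 2 (spectralMeasure hS x))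
    (hg : MemLp g 2 (spectralMeasure hS (cyclicMap hS x (hk.toLp k))))
    (hgk : MemLp (g * k) 2 (spectralMeasure hS x)) :
    cyclicMap hS (cyclicMap hS x (hk.toLp k)) (hg.toLp g) =
      cyclicMap hS x (hgk.toLp (g * k)) := by
  obtain ⟨a, ha, -⟩ := exists_seq_approx _ _ hg hg
  refine tendsto_nhds_unique (tendsto_cfcHom hS hg ha) ?_
  have hak := fun n => memLp_continuous_mul hS (a n) hk
  simp only [fun n => cfcHom_cyclicMap hS (a n) hk (hak n)]
  refine tendsto_cyclicMap hS hak hgk ?_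
  -- The density |k|² turns the L² error of a n at the vector k(S)x into the L² error of (a n) k at
  -- x.
  have h1 : ∀ n, eLpNorm (⇑(a n) * k - g * k) 2 (spectralMeasure hS x) =
      eLpNorm (g - ⇑(a n)) 2 (spectralMeasure hS (cyclicMap hS x (hk.toLp k))) := fun n => by
    rw [spectralMeasure_cyclicMap hS hkm, eLpNorm_withDensity_enorm_sq _ hkm, sub_mul,
      eLpNorm_sub_comm]
  simp only [h1]
  rwa [← ENNReal.tendsto_toReal_iff (fun n => (hg.sub (memLp_continuous _ (a n))).2.ne) (by simp)]

/-- One sequence of continuous functions approximates g in both L²(μ_x) and L²(μ_y); its conjugates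
approximate the conjugate of g, and for continuous functions the identity is the `*`-property of
`cfcHom`. -/
theorem inner_cyclicMap_star {x y : H} {g : spectrum ℂ S → ℂ}
    (hx : MemLp g 2 (spectralMeasure hS x)) (hy : MemLp g 2 (spectralMeasure hS y))
    (hy' : MemLp (star g) 2 (spectralMeasure hS y)) :
    ⟪cyclicMap hS x (hx.toLp g), y⟫_ℂ = ⟪x, cyclicMap hS y (hy'.toLp (star g))⟫_ℂ := by
  obtain ⟨a, ha, hb⟩ := exists_seq_approx _ _ hx hy
  have h1 : ∀ n, eLpNorm (star g - ⇑(star (a n))) 2 (spectralMeasure hS y) =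
      eLpNorm (g - ⇑(a n)) 2 (spectralMeasure hS y) := fun n => by
    refine eLpNorm_congr_norm_ae (ae_of_all _ fun t => ?_)
    simp only [Pi.sub_apply, Pi.star_apply, ContinuousMap.coe_star, ← star_sub, norm_star]
  simp only [← h1] at hb
  have h2 := (tendsto_cfcHom hS hx ha).inner (𝕜 := ℂ) (tendsto_const_nhds (x := y))
  have h3 := (tendsto_const_nhds (x := x)).inner (𝕜 := ℂ) (tendsto_cfcHom hS hy' hb)
  refine tendsto_nhds_unique h2 (h3.congr fun n => ?_)
  rw [map_star, ContinuousLinearMap.star_eq_adjoint, ContinuousLinearMap.adjoint_inner_right]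

/-- Approximating g simultaneously in L²(μ_x) and L²(μ_{Rx}) avoids any comparison of the two
measures. -/
theorem cyclicMap_comm {x : H} {g : spectrum ℂ S → ℂ} {R : H →L[ℂ] H}
    (hR : ∀ h : C(spectrum ℂ S, ℂ), Commute R (cfcHom hS h))
    (hx : MemLp g 2 (spectralMeasure hS x)) (hy : MemLp g 2 (spectralMeasure hS (R x))) :
    R (cyclicMap hS x (hx.toLp g)) = cyclicMap hS (R x) (hy.toLp g) := by
  obtain ⟨a, ha, hb⟩ := exists_seq_approx _ _ hx hy
  refine tendsto_nhds_unique ((R.continuous.tendsto _).comp (tendsto_cfcHom hS hx ha))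
    ((tendsto_cfcHom hS hy hb).congr fun n => ?_)
  exact (congrArg (fun A : H →L[ℂ] H => A x) (hR (a n))).symm

/-! ### Bounded Borel functions of a bounded normal operator -/

theorem boundedBorel_memLp {X : Set ℂ} (μ : Measure X) [IsFiniteMeasure μ] (g : boundedBorel X) :
    MemLp (g : X → ℂ) 2 μ :=
  MemLp.of_bound g.2.1.aestronglyMeasurable g.2.2.choose (ae_of_all _ g.2.2.choose_spec)

theorem norm_cyclicMap_le {x : H} {g : spectrum ℂ S → ℂ} (hg : MemLp g 2 (spectralMeasure hS x))
    {C : ℝ} (hC : ∀ t, ‖g t‖ ≤ C) : ‖cyclicMap hS x (hg.toLp g)‖ ≤ C * ‖x‖ := by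
  -- If the spectrum is empty, C may be negative; then L²(μ_x) is zero, and so is x, being the image
  -- of the function 1.
  rcases isEmpty_or_nonempty (spectrum ℂ S) with hE | ⟨⟨t⟩⟩
  · have h1 : ∀ (k : spectrum ℂ S → ℂ) (hk : MemLp k 2 (spectralMeasure hS x)),
        cyclicMap hS x (hk.toLp k) = 0 := fun k hk => by
      obtain rfl : k = 0 := Subsingleton.elim _ _
      rw [MemLp.toLp_zero, map_zero]
    have h2 : x = 0 := (cyclicMap_one hS x (memLp_continuous (spectralMeasure hS x) 1)).symm.trans
      (h1 _ _)
    rw [h1, h2]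
    simp
  have h0 : 0 ≤ C := (norm_nonneg _).trans (hC t)
  have h1 : MemLp (1 : spectrum ℂ S → ℂ) 2 (spectralMeasure hS x) :=
    memLp_continuous (spectralMeasure hS x) 1
  conv_rhs => rw [← cyclicMap_one hS x h1]
  rw [norm_cyclicMap, norm_cyclicMap, Lp.norm_toLp, Lp.norm_toLp, ← ENNReal.toReal_ofReal h0,
    ← ENNReal.toReal_mul]
  refine ENNReal.toReal_mono (ENNReal.mul_ne_top ENNReal.ofReal_ne_top h1.2.ne) ?_
  exact eLpNorm_le_mul_eLpNorm_of_ae_le_mul (ae_of_all _ fun t => by simpa using hC t) 2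

/-- The bounded operator `g(S)` for a bounded Borel function `g` on `σ(S)`. -/
def boundedBorelCalculus (g : boundedBorel (spectrum ℂ S)) : H →L[ℂ] H :=
  LinearMap.mkContinuous
    { toFun := fun x => cyclicMap hS x ((boundedBorel_memLp _ g).toLp g)
      map_add' := fun _ _ => cyclicMap_add hS _ _ _
      map_smul' := fun c _ => cyclicMap_smul hS c _ _ } g.2.2.choose
    fun _ => norm_cyclicMap_le hS _ g.2.2.choose_spec

theorem boundedBorelCalculus_apply (g : boundedBorel (spectrum ℂ S)) (x : H) :
    boundedBorelCalculus hS g x = cyclicMap hS x ((boundedBorel_memLp _ g).toLp g) := rfl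

theorem norm_boundedBorelCalculus_le (g : boundedBorel (spectrum ℂ S)) {C : ℝ} (h0 : 0 ≤ C)
    (hC : ∀ t, ‖(g : spectrum ℂ S → ℂ) t‖ ≤ C) : ‖boundedBorelCalculus hS g‖ ≤ C :=
  ContinuousLinearMap.opNorm_le_bound _ h0 fun _ => norm_cyclicMap_le hS _ hC

theorem boundedBorelCalculus_add (f g : boundedBorel (spectrum ℂ S)) :
    boundedBorelCalculus hS (f + g) = boundedBorelCalculus hS f + boundedBorelCalculus hS g := by
  ext x
  simp only [add_apply, boundedBorelCalculus_apply, ← map_add]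
  rfl

theorem boundedBorelCalculus_smul (c : ℂ) (g : boundedBorel (spectrum ℂ S)) :
    boundedBorelCalculus hS (c • g) = c • boundedBorelCalculus hS g := by
  ext x
  simp only [smul_apply, boundedBorelCalculus_apply, ← map_smul]
  rfl

theorem boundedBorelCalculus_one : boundedBorelCalculus hS 1 = 1 := by
  ext x
  exact cyclicMap_one hS x _

theorem boundedBorelCalculus_mul (f g : boundedBorel (spectrum ℂ S)) :
    boundedBorelCalculus hS (f * g) = boundedBorelCalculus hS f * boundedBorelCalculus hS g := by
  ext x
  exact (cyclicMap_cyclicMap hS g.2.1 _ _ _).symm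

theorem boundedBorelCalculus_star (g : boundedBorel (spectrum ℂ S)) :
    boundedBorelCalculus hS (star g) = star (boundedBorelCalculus hS g) := by
  rw [ContinuousLinearMap.star_eq_adjoint, ContinuousLinearMap.eq_adjoint_iff]
  intro x y
  rw [← inner_conj_symm, ← inner_conj_symm x]
  exact congrArg _ (inner_cyclicMap_star hS (boundedBorel_memLp _ g) (boundedBorel_memLp _ g)
    (boundedBorel_memLp _ (star g))).symm

/-- This is what makes the values of f ∘ u at ±1 irrelevant. -/
theorem boundedBorelCalculus_congr {f g : boundedBorel (spectrum ℂ S)}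
    (h : ∀ x, (f : spectrum ℂ S → ℂ) =ᵐ[spectralMeasure hS x] g) :
    boundedBorelCalculus hS f = boundedBorelCalculus hS g := by
  ext x
  exact congrArg _ (MemLp.toLp_congr _ _ (h x))

theorem boundedBorelCalculus_comm {R : H →L[ℂ] H}
    (hR : ∀ h : C(spectrum ℂ S, ℂ), Commute R (cfcHom hS h)) (g : boundedBorel (spectrum ℂ S)) :
    Commute R (boundedBorelCalculus hS g) := by
  ext x
  exact cyclicMap_comm hS hR _ _

theorem borelCalculus_eq_boundedBorelCalculus (g : boundedBorel (spectrum ℂ S)) :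
    borelCalculus hS g = (boundedBorelCalculus hS g : H →ₗ[ℂ] H).toPMap ⊤ := by
  refine LinearPMap.ext (eq_top_iff.2 fun x _ => ?_) fun x _ _ => rfl
  exact boundedBorel_memLp _ g

/-- The indicator function of the set `{|g| ≤ m}`. -/
def levelIndicator {X : Set ℂ} {g : X → ℂ} (hg : Measurable g) (m : ℕ) :
    boundedBorel (X) :=
  ⟨Set.indicator {t | ‖g t‖ ≤ m} 1, measurable_one.indicator (hg.norm measurableSet_Iic), 1,
    fun t => by
      by_cases h : ‖g t‖ ≤ m <;> simp [Set.indicator, h]⟩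

/-- The product of `g` and the indicator function of the set `{|g| ≤ m}`. -/
def truncate {X : Set ℂ} {g : X → ℂ} (hg : Measurable g) (m : ℕ) :
    boundedBorel (X) :=
  ⟨g * (levelIndicator hg m : X → ℂ), hg.mul (levelIndicator hg m).2.1, m,
    fun t => by
      by_cases h : ‖g t‖ ≤ m <;> simp [levelIndicator, Set.indicator, h]⟩

theorem levelIndicator_eventually {X : Set ℂ} {g : X → ℂ} (hg : Measurable g) (t : X) :
    ∀ᶠ m in atTop, (levelIndicator hg m : X → ℂ) t = 1 := by
  filter_upwards [eventually_ge_atTop ⌈‖g t‖⌉₊] with m hm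
  have : ‖g t‖ ≤ m := Nat.ceil_le.1 hm
  simp [levelIndicator, Set.indicator, this]

theorem norm_levelIndicator_le {X : Set ℂ} {g : X → ℂ} (hg : Measurable g) (m : ℕ)
    (t : X) : ‖(levelIndicator hg m : X → ℂ) t‖ ≤ 1 := by
  by_cases h : ‖g t‖ ≤ m <;> simp [levelIndicator, Set.indicator, h]

/-- Dominated convergence with majorant (2|k|)²: at each point the indicator is eventually 1. -/
theorem tendsto_eLpNorm_levelIndicator_mul {X : Set ℂ} {g k : X → ℂ} (hg : Measurable g)
    {μ : Measure (X)} (hk : MemLp k 2 μ) :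
    Tendsto (fun m => eLpNorm (k * (levelIndicator hg m : X → ℂ) - k) 2 μ) atTop
      (𝓝 0) := by
  have h1 : Tendsto (fun m => ∫⁻ t, ‖(k * (levelIndicator hg m : X → ℂ) - k) t‖ₑ ^ 2 ∂μ)
      atTop (𝓝 (∫⁻ _, 0 ∂μ)) := by
    refine tendsto_lintegral_of_dominated_convergence' (fun t => (2 * ‖k t‖ₑ) ^ 2) (fun m => ?_)
      (fun m => ae_of_all _ fun t => ?_) ?_ (ae_of_all _ fun t => ?_)
    · exact (((hk.1.mul (levelIndicator hg m).2.1.aestronglyMeasurable).sub hk.1).enorm).pow_const 2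
    · refine pow_le_pow_left' ?_ 2
      rw [two_mul]
      refine (enorm_sub_le).trans (add_le_add ?_ le_rfl)
      rw [Pi.mul_apply, enorm_mul]
      refine mul_le_of_le_one_right' ?_
      rw [← ofReal_norm]
      exact ENNReal.ofReal_le_one.2 (norm_levelIndicator_le hg m t)
    · simp only [mul_pow]
      rw [lintegral_const_mul' _ _ (by simp)]
      exact ENNReal.mul_ne_top (by simp) (lintegral_enorm_sq_ne_top hk)
    · refine tendsto_const_nhds.congr' ?_
      filter_upwards [levelIndicator_eventually hg t] with m hm
      simp [hm]
  rw [lintegral_zero] at h1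
  have h2 := (ENNReal.continuous_rpow_const (y := (1 / 2 : ℝ))).tendsto 0 |>.comp h1
  rw [ENNReal.zero_rpow_of_pos (by norm_num)] at h2
  refine h2.congr fun m => ?_
  rw [eLpNorm_eq_lintegral_rpow_enorm_toReal (by simp) (by simp)]
  simp

/-! ### Unbounded Borel functions: graph, closedness, density of the domain, commutation -/

theorem tendsto_levelIndicator {g : spectrum ℂ S → ℂ} (hg : Measurable g) (x : H) :
    Tendsto (fun m => boundedBorelCalculus hS (levelIndicator hg m) x) atTop (𝓝 x) := by
  have h1 : MemLp (1 : spectrum ℂ S → ℂ) 2 (spectralMeasure hS x) :=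
    memLp_continuous (spectralMeasure hS x) 1
  have h2 := tendsto_cyclicMap hS (fun m => boundedBorel_memLp _ (levelIndicator hg m)) h1
    (by simpa using tendsto_eLpNorm_levelIndicator_mul hg h1)
  rwa [cyclicMap_one] at h2

theorem mem_graph_borelCalculus {g : spectrum ℂ S → ℂ} {x y : H} :
    (x, y) ∈ (borelCalculus hS g).graph ↔
      ∃ h : MemLp g 2 (spectralMeasure hS x), cyclicMap hS x (h.toLp g) = y := by
  rw [LinearPMap.mem_graph_iff']
  constructor
  · rintro ⟨z, hz⟩
    simp only [Prod.mk.injEq] at hz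
    obtain ⟨rfl, rfl⟩ := hz
    exact ⟨z.2, rfl⟩
  · rintro ⟨h, rfl⟩
    exact ⟨⟨x, h⟩, rfl⟩

/-- Describes the graph of an unbounded g(S) by countably many equations between bounded operators.
Applying 1_m(S) to y = g(S)x gives one direction; conversely, the equations bound the truncations of
g in L²(μ_x) uniformly, and the limit m → ∞ recovers y. -/
theorem mem_graph_borelCalculus_iff {g : spectrum ℂ S → ℂ} (hg : Measurable g) {x y : H} :
    (x, y) ∈ (borelCalculus hS g).graph ↔ ∀ m, boundedBorelCalculus hS (truncate hg m) x =
      boundedBorelCalculus hS (levelIndicator hg m) y := by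
  rw [mem_graph_borelCalculus]
  constructor
  · rintro ⟨h, rfl⟩ m
    refine Eq.trans ?_ (cyclicMap_cyclicMap hS hg h _ ?_).symm
    · exact congrArg _ (MemLp.toLp_congr _ _ (ae_of_all _ fun t => mul_comm _ _))
    · refine (memLp_congr_ae (ae_of_all _ fun t => mul_comm _ _)).1
        (boundedBorel_memLp _ (truncate hg m))
  · intro h
    have h1 : Tendsto (fun m => boundedBorelCalculus hS (truncate hg m) x) atTop (𝓝 y) := by
      simp only [h]
      exact tendsto_levelIndicator hS hg y
    have hmem : MemLp g 2 (spectralMeasure hS x) := by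
      refine ⟨hg.aestronglyMeasurable, ?_⟩
      -- By the isometry this norm is that of (g 1_m)(S)x = 1_m(S)y, and 1_m(S) is a contraction.
      have h2 : ∀ m, eLpNorm (truncate hg m : spectrum ℂ S → ℂ) 2 (spectralMeasure hS x) ≤ ‖y‖ₑ := by
        intro m
        have h3 := norm_cyclicMap hS x
          ((boundedBorel_memLp (spectralMeasure hS x) (truncate hg m)).toLp _)
        rw [Lp.norm_toLp, ← boundedBorelCalculus_apply, h] at h3
        rw [← ENNReal.ofReal_toReal (boundedBorel_memLp (spectralMeasure hS x) (truncate hg m)).2.ne,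
          ← h3, ← ofReal_norm]
        refine ENNReal.ofReal_le_ofReal ?_
        simpa [boundedBorelCalculus_apply] using norm_cyclicMap_le hS (boundedBorel_memLp (spectralMeasure hS y) _)
          (norm_levelIndicator_le hg m)
      -- Fatou's lemma carries the uniform bound from the truncations to g.
      refine lt_of_le_of_lt ((Lp.eLpNorm_lim_le_liminf_eLpNorm (f := fun m =>
        (truncate hg m : spectrum ℂ S → ℂ)) (fun m => (truncate hg m).2.1.aestronglyMeasurable) g
        (ae_of_all _ fun t => ?_)).trans (liminf_le_of_le (by isBoundedDefault)
          (a := ‖y‖ₑ) fun b hb => ?_)) enorm_lt_top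
      · refine tendsto_const_nhds.congr' ?_
        filter_upwards [levelIndicator_eventually hg t] with m hm
        simp [truncate, hm]
      · obtain ⟨m, hm⟩ := hb.exists
        exact hm.trans (h2 m)
    exact ⟨hmem, tendsto_nhds_unique (tendsto_cyclicMap hS
      (fun m => boundedBorel_memLp _ (truncate hg m)) hmem
      (tendsto_eLpNorm_levelIndicator_mul hg hmem)) h1⟩

theorem isClosed_borelCalculus {g : spectrum ℂ S → ℂ} (hg : Measurable g) :
    (borelCalculus hS g).IsClosed := by
  have h : ((borelCalculus hS g).graph : Set (H × H)) =
      ⋂ m, {p | boundedBorelCalculus hS (truncate hg m) p.1 =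
        boundedBorelCalculus hS (levelIndicator hg m) p.2} := by
    ext ⟨x, y⟩
    simpa using mem_graph_borelCalculus_iff hS hg
  rw [LinearPMap.IsClosed, h]
  exact isClosed_iInter fun m => isClosed_eq (by fun_prop) (by fun_prop)

/-- The vectors 1_m(S)x lie in the domain because g 1_m is bounded, and they converge to x. -/
theorem dense_domain_borelCalculus {g : spectrum ℂ S → ℂ} (hg : Measurable g) :
    Dense ((borelCalculus hS g).domain : Set H) := fun x =>
  mem_closure_of_tendsto (tendsto_levelIndicator hS hg x) <| Eventually.of_forall fun m =>
    (memLp_mul_of_memLp_spectralMeasure hS hg (levelIndicator hg m).2.1 _).2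
      (boundedBorel_memLp _ (truncate hg m))

theorem commutes_borelCalculus {g : spectrum ℂ S → ℂ} (hg : Measurable g) {R : H →L[ℂ] H}
    (hR : ∀ h : C(spectrum ℂ S, ℂ), Commute R (cfcHom hS h)) :
    Commutes (borelCalculus hS g) R := by
  rw [commutes_iff]
  intro x y hxy
  rw [mem_graph_borelCalculus_iff hS hg] at hxy ⊢
  have hc : ∀ (f : boundedBorel (spectrum ℂ S)) (z : H),
      boundedBorelCalculus hS f (R z) = R (boundedBorelCalculus hS f z) := fun f z =>
    (congrArg (fun A : H →L[ℂ] H => A z) (boundedBorelCalculus_comm hS hR f)).symm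
  intro m
  rw [hc, hc, hxy]

end

/-! Commutants of a self-adjoint operator and of its bounded transform -/

section

variable (T : H →ₗ.[ℂ] H) (hT : IsSelfAdjoint T)

theorem sqrt_boundedTransform_mem_graph (x : H) :
    (CFC.sqrt (invOnePlusSq T hT) x, boundedTransform T hT x) ∈ T.graph :=
  T.mem_graph ⟨_, sqrt_mem_domain T hT x⟩

theorem eq_of_sqrt_mem_graph {x y : H} (h : (CFC.sqrt (invOnePlusSq T hT) x, y) ∈ T.graph) :
    y = boundedTransform T hT x :=
  T.mem_graph_snd_inj h (sqrt_boundedTransform_mem_graph T hT x) rfl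

theorem sqrt_boundedTransform (x : H) : CFC.sqrt (invOnePlusSq T hT) (boundedTransform T hT x) =
    boundedTransform T hT (CFC.sqrt (invOnePlusSq T hT) x) :=
  eq_of_sqrt_mem_graph T hT (commutes_iff.1 (sqrt_mem_commutant T hT) _ _
    (sqrt_boundedTransform_mem_graph T hT x))

theorem boundedTransform_sqrt_mem_graph (x : H) :
    (boundedTransform T hT (CFC.sqrt (invOnePlusSq T hT) x), x - invOnePlusSq T hT x) ∈ T.graph := by
  obtain ⟨z, h, h'⟩ := invOnePlusSq_spec T hT x
  rw [← sqrt_sqrt] at h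
  rwa [eq_of_sqrt_mem_graph T hT h] at h'

theorem boundedTransform_boundedTransform (x : H) :
    boundedTransform T hT (boundedTransform T hT x) = x - invOnePlusSq T hT x := by
  have h := boundedTransform_sqrt_mem_graph T hT x
  rw [← sqrt_boundedTransform] at h
  exact (eq_of_sqrt_mem_graph T hT h).symm

/-- Shows that the domain of T is contained in the range of Q. The point is QSy = TQ²y = T(1 +
T²)⁻¹Tx = x - Q²x. -/
theorem eq_sqrt_of_mem_graph {x y : H} (h : (x, y) ∈ T.graph) :
    x = CFC.sqrt (invOnePlusSq T hT)
      (CFC.sqrt (invOnePlusSq T hT) x + boundedTransform T hT y) := by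
  have h1 := commutes_iff.1 (invOnePlusSq_mem_commutant T hT) _ _ h
  rw [← sqrt_sqrt] at h1
  have h2 := boundedTransform_sqrt_mem_graph T hT x
  rw [← eq_of_sqrt_mem_graph T hT h1, ← sqrt_sqrt T hT y] at h2
  rw [map_add, sqrt_boundedTransform, ← eq_of_sqrt_mem_graph T hT h2, sqrt_sqrt, add_sub_cancel]

theorem commute_sqrt {R : H →L[ℂ] H} (h : Commute (invOnePlusSq T hT) R) :
    Commute (CFC.sqrt (invOnePlusSq T hT)) R := by
  have h0 := invOnePlusSq_nonneg T hT
  rw [CFC.sqrt_eq_real_sqrt _ h0, cfcₙ_eq_cfc]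
  exact h.cfc (by rwa [(IsSelfAdjoint.of_nonneg h0).star_eq]) _

theorem commutes_iff_commute {R : H →L[ℂ] H} :
    Commutes T R ↔ Commute (boundedTransform T hT) R := by
  rw [commutes_iff]
  constructor
  · intro h
    -- R carries the solution of y + TTy = x to a solution for Rx, and solutions are unique.
    have h1 : Commute (invOnePlusSq T hT) R := by
      ext x
      obtain ⟨z, hz, hz'⟩ := invOnePlusSq_spec T hT x
      obtain ⟨w, hw, hw'⟩ := invOnePlusSq_spec T hT (R x)
      have h2 := h _ _ hz'
      rw [map_sub] at h2
      exact (unique_onePlusSq hT hw hw' (h _ _ hz) h2).1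
    have h2 : ∀ x, CFC.sqrt (invOnePlusSq T hT) (R x) = R (CFC.sqrt (invOnePlusSq T hT) x) :=
      fun x => congrArg (fun A : H →L[ℂ] H => A x) (commute_sqrt T hT h1)
    ext x
    have h3 := h _ _ (sqrt_boundedTransform_mem_graph T hT x)
    rw [← h2] at h3
    exact (eq_of_sqrt_mem_graph T hT h3).symm
  · intro h x y hxy
    have h0 : invOnePlusSq T hT = 1 - boundedTransform T hT * boundedTransform T hT := by
      ext x
      simp [mul_apply_eq_comp, boundedTransform_boundedTransform]
    have h1 : Commute (invOnePlusSq T hT) R := by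
      rw [h0]
      exact (Commute.one_left R).sub_left (h.mul_left h)
    have h2 : ∀ x, CFC.sqrt (invOnePlusSq T hT) (R x) = R (CFC.sqrt (invOnePlusSq T hT) x) :=
      fun x => congrArg (fun A : H →L[ℂ] H => A x) (commute_sqrt T hT h1)
    have h3 : ∀ x, boundedTransform T hT (R x) = R (boundedTransform T hT x) :=
      fun x => congrArg (fun A : H →L[ℂ] H => A x) h
    -- Write x = Qz; then y = Sz, and Rx = QRz is mapped by T to SRz = RSz.
    have hx := eq_sqrt_of_mem_graph T hT hxy
    generalize CFC.sqrt (invOnePlusSq T hT) x + boundedTransform T hT y = z at hx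
    subst hx
    rw [eq_of_sqrt_mem_graph T hT hxy, ← h2, ← h3]
    exact sqrt_boundedTransform_mem_graph T hT _

theorem coe_commutant : (commutant T hT : Set (H →L[ℂ] H)) =
    Set.centralizer (StarAlgebra.elemental ℂ (boundedTransform T hT) : Set (H →L[ℂ] H)) := by
  ext R
  constructor
  · intro hR
    have h1 : Commute (boundedTransform T hT) R := (commutes_iff_commute T hT).1 hR
    have h2 : Commute (boundedTransform T hT) (star R) :=
      (commutes_iff_commute T hT).1 (Commutes.adjoint hT hR)
    -- The operators commuting with both R and R* form a closed `*`-subalgebra; it contains S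
    -- because {T}' is closed under adjoints.
    have h3 : StarAlgebra.elemental ℂ (boundedTransform T hT) ≤
        StarSubalgebra.centralizer ℂ {R} := by
      refine StarAlgebra.elemental.le_of_mem ?_ ?_
      · rw [StarSubalgebra.coe_centralizer]
        exact Set.isClosed_centralizer _
      · rw [StarSubalgebra.mem_centralizer_iff]
        rintro g rfl
        exact ⟨h1.symm, h2.symm⟩
    intro A hA
    exact ((StarSubalgebra.mem_centralizer_iff ℂ).1 (h3 hA) R rfl).1.symm
  · intro hR
    exact (commutes_iff_commute T hT).2 (hR _ (StarAlgebra.elemental.self_mem _ _))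

theorem wStar_eq_wStarBounded : wStar T hT = wStarBounded (boundedTransform T hT) := by
  refine SetLike.coe_injective ?_
  rw [wStar, wStarBounded, VonNeumannAlgebra.coe_commutant, coe_vnCommutant, coe_vnCommutant,
    coe_commutant]

theorem commute_cfcHom {R : H →L[ℂ] H} (hR : R ∈ commutant T hT)
    (hS : IsStarNormal (boundedTransform T hT)) (h : C(spectrum ℂ (boundedTransform T hT), ℂ)) :
    Commute R (cfcHom hS h) := by
  rw [← SetLike.mem_coe, coe_commutant] at hR
  exact (hR _ (cfcHom_mem_elemental _ _)).symm

theorem mem_commutant_of_mem_wStar_commutant {R : H →L[ℂ] H} (hR : R ∈ (wStar T hT).commutant) :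
    R ∈ commutant T hT := by
  rw [← SetLike.mem_coe, VonNeumannAlgebra.coe_commutant, wStar, coe_vnCommutant,
    coe_commutant, Set.centralizer_centralizer_centralizer, ← coe_commutant] at hR
  exact hR

/-! The spectrum of the bounded transform -/

theorem norm_boundedTransform_apply_le (x : H) : ‖boundedTransform T hT x‖ ≤ ‖x‖ := by
  have h1 : ⟪boundedTransform T hT x, boundedTransform T hT x⟫_ℂ =
      ⟪x, x⟫_ℂ - ⟪CFC.sqrt (invOnePlusSq T hT) x, CFC.sqrt (invOnePlusSq T hT) x⟫_ℂ := by
    rw [inner_sqrt, sqrt_sqrt, ← inner_sub_right, ← boundedTransform_boundedTransform]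
    exact ContinuousLinearMap.isSelfAdjoint_iff_isSymmetric.1
      (isSelfAdjoint_boundedTransform T hT) _ _
  have h2 := congrArg RCLike.re h1
  rw [map_sub, inner_self_eq_norm_sq, inner_self_eq_norm_sq, inner_self_eq_norm_sq] at h2
  refine (sq_le_sq₀ (norm_nonneg _) (norm_nonneg _)).1 ?_
  linarith [sq_nonneg ‖CFC.sqrt (invOnePlusSq T hT) x‖]

theorem norm_le_one_of_mem_spectrum {z : ℂ} (hz : z ∈ spectrum ℂ (boundedTransform T hT)) :
    ‖z‖ ≤ 1 := by
  have h1 := spectrum.norm_le_norm_mul_of_mem hz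
  have h2 : ‖boundedTransform T hT‖ ≤ 1 := ContinuousLinearMap.opNorm_le_bound _ zero_le_one
    fun x => by simpa using norm_boundedTransform_apply_le T hT x
  have h3 : ‖(1 : H →L[ℂ] H)‖ ≤ 1 := ContinuousLinearMap.norm_id_le
  exact h1.trans (mul_le_one₀ h2 (norm_nonneg _) h3)

theorem re_mem_Ioo_of_mem_spectrum {z : ℂ} (hz : z ∈ spectrum ℂ (boundedTransform T hT))
    (hz' : z ^ 2 ≠ 1) : z.re ∈ Set.Ioo (-1 : ℝ) 1 := by
  have h1 := (isSelfAdjoint_boundedTransform T hT).mem_spectrum_eq_re hz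
  have h2 := norm_le_one_of_mem_spectrum T hT hz
  have h3 := (Complex.abs_re_le_norm z).trans h2
  rw [abs_le] at h3
  refine ⟨lt_of_le_of_ne h3.1 fun h => hz' ?_, lt_of_le_of_ne h3.2 fun h => hz' ?_⟩
  · rw [h1, ← h]; norm_num
  · rw [h1, h]; norm_num

/-- Let p = 1_E(S)x with E = {t² = 1}. Then (1 - S²)p = 0, and 1 - S² = (1 + T²)⁻¹ is injective, so
p = 0; since V_x is isometric, E is null. -/
theorem ae_sq_ne_one (hS : IsStarNormal (boundedTransform T hT)) (x : H) :
    ∀ᵐ t : spectrum ℂ (boundedTransform T hT) ∂(spectralMeasure hS x),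
      (t : ℂ) ^ 2 ≠ 1 := by
  let E : Set (spectrum ℂ (boundedTransform T hT)) := {t | (t : ℂ) ^ 2 = 1}
  have hE : MeasurableSet E :=
    (isClosed_eq (by fun_prop) continuous_const : IsClosed E).measurableSet
  let g : spectrum ℂ (boundedTransform T hT) → ℂ := E.indicator 1
  have hg : MemLp g 2 (spectralMeasure hS x) :=
    (memLp_continuous (spectralMeasure hS x) 1).indicator hE
  let i : C(spectrum ℂ (boundedTransform T hT), ℂ) := (ContinuousMap.id ℂ).restrict _
  have h1 := cfcHom_cyclicMap hS (1 - i * i) hg (memLp_continuous_mul hS _ hg)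
  have h2 : ⇑(1 - i * i) * g = 0 := by
    ext t
    by_cases ht : (t : ℂ) ^ 2 = 1
    · simp [i, ← sq, ht]
    · have : t ∉ E := ht
      simp [g, this]
  rw [MemLp.toLp_congr _ (MemLp.zero' : MemLp 0 2 _) (ae_of_all _ fun t => congrFun h2 t)] at h1
  rw [MemLp.toLp_zero, map_zero, map_sub, map_one, map_mul, cfcHom_id hS] at h1
  set p := cyclicMap hS x (hg.toLp g)
  have h3 : invOnePlusSq T hT p = 0 := by
    rw [← h1]
    simp [mul_apply_eq_comp, boundedTransform_boundedTransform]
  have h4 : p = 0 := by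
    obtain ⟨z, k, k'⟩ := invOnePlusSq_spec T hT p
    rw [h3] at k k'
    have hz : z = 0 := T.graph_fst_eq_zero_snd k rfl
    rw [hz, sub_zero] at k'
    exact T.graph_fst_eq_zero_snd k' rfl
  have h5 : hg.toLp g = 0 := by
    rw [← norm_eq_zero, ← norm_cyclicMap]
    exact norm_eq_zero.2 h4
  have h6 : g =ᵐ[spectralMeasure hS x] 0 := hg.coeFn_toLp.symm.trans (h5 ▸ Lp.coeFn_zero _ _ _)
  filter_upwards [h6] with t ht ht'
  have : t ∈ E := ht'
  simp [g, this] at ht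

/-- The lower bound gives injectivity and closed range; the orthogonal complement of the range is
the kernel, which is zero. -/
theorem isUnit_of_isSelfAdjoint_of_norm_le {A : H →L[ℂ] H} (hA : IsSelfAdjoint A) {c : NNReal}
    (h : ∀ x, ‖x‖ ≤ c * ‖A x‖) : IsUnit A := by
  rw [ContinuousLinearMap.isUnit_iff_bijective,
    ContinuousLinearMap.bijective_iff_dense_range_and_antilipschitz]
  refine ⟨?_, c, A.antilipschitz_of_bound h⟩
  rw [Submodule.topologicalClosure_eq_top_iff, Submodule.eq_bot_iff]
  intro v hv
  have h1 : A v = 0 := by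
    rw [← inner_self_eq_zero (𝕜 := ℂ)]
    refine Eq.trans (ContinuousLinearMap.isSelfAdjoint_iff_isSymmetric.1 hA v (A v)) ?_
    exact (Submodule.mem_orthogonal' _ v).1 hv _ ⟨A v, rfl⟩
  have h2 := h v
  rw [h1, norm_zero, mul_zero] at h2
  exact norm_le_zero_iff.1 h2

variable {T} in
-- The spectrum is defined by bijectivity alone; boundedness of the inverse comes from the closed
-- graph theorem, as T is closed.
theorem exists_norm_le_of_notMem_opSpectrum (hT : IsSelfAdjoint T) {z : ℂ}
    (hz : z ∉ opSpectrum T) :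
    ∃ K : NNReal, ∀ x y, (x, y) ∈ T.graph → ‖x‖ ≤ K * ‖y - z • x‖ := by
  have hb : Function.Bijective (T.toFun - z • T.domain.subtype) := not_not.1 hz
  let e : T.domain ≃ₗ[ℂ] H := LinearEquiv.ofBijective _ hb
  let g : H →ₗ[ℂ] H := T.domain.subtype ∘ₗ e.symm.toLinearMap
  have hg : ∀ x y, (x, y) ∈ T.graph ↔ x = g (y - z • x) := by
    intro x y
    constructor
    · intro h
      obtain ⟨w, hw⟩ := T.mem_graph_iff'.1 h
      simp only [Prod.mk.injEq] at hw
      obtain ⟨rfl, rfl⟩ := hw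
      have : T w - z • (w : H) = e w := rfl
      rw [this]
      simp [g]
    · intro h
      have h1 : x = e.symm (y - z • x) := h
      have h2 : T (e.symm (y - z • x)) - z • (e.symm (y - z • x) : H) = y - z • x :=
        e.apply_symm_apply _
      rw [← h1, sub_left_inj] at h2
      have h3 := T.mem_graph (e.symm (y - z • x))
      rwa [h2, ← h1] at h3
  have hc : Continuous g := by
    refine LinearMap.continuous_of_isClosed_graph g ?_
    have h1 : (g.graph : Set (H × H)) = (fun p : H × H => (p.2, p.1 + z • p.2)) ⁻¹' T.graph := by
      ext ⟨a, b⟩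
      simp only [SetLike.mem_coe, LinearMap.mem_graph_iff, Set.mem_preimage, hg, add_sub_cancel_right]
    rw [h1]
    exact hT.isClosed.preimage (by fun_prop)
  refine ⟨‖(⟨g, hc⟩ : H →L[ℂ] H)‖₊, fun x y h => ?_⟩
  conv_lhs => rw [(hg x y).1 h]
  exact (⟨g, hc⟩ : H →L[ℂ] H).le_opNorm _

theorem mul_norm_le_norm_add_smul {E : Type*} [NormedAddCommGroup E] [InnerProductSpace ℂ E]
    {Q : E →L[ℂ] E} (hQ : 0 ≤ Q) {q : ℝ} (v : E) :
    q * ‖v‖ ≤ ‖Q v + (q : ℂ) • v‖ := by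
  rcases eq_or_ne v 0 with rfl | hv
  · simp
  have h1 := ((ContinuousLinearMap.nonneg_iff_isPositive Q).1 hQ).re_inner_nonneg_left v
  have h2 : RCLike.re ⟪Q v + (q : ℂ) • v, v⟫_ℂ ≤ _ := re_inner_le_norm _ _
  rw [inner_add_left, inner_smul_left, map_add, Complex.conj_ofReal] at h2
  have h3 : RCLike.re ((q : ℂ) * ⟪v, v⟫_ℂ) = q * ‖v‖ ^ 2 := by
    rw [← inner_self_eq_norm_sq (𝕜 := ℂ)]
    exact RCLike.re_ofReal_mul _ _
  rw [h3] at h2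
  refine le_of_mul_le_mul_right ?_ (norm_pos_iff.2 hv)
  nlinarith

/-- If u(s) is outside σ(T), then S - s is bounded below, hence invertible. Put q = √(1 - s²), w =
(S - s)x and v = (Q - q)x. From S² + Q² = 1 = s² + q² one gets (Q + q)v = -(S + s)w, so v is
controlled by w. Since u(s)q = s, (T - u(s))Qx = w - u(s)v; the resolvent bound controls Qx, and
then qx = Qx - v. -/
theorem u_mem_opSpectrum {s : ℝ} (hs : s ∈ Set.Ioo (-1 : ℝ) 1)
    (h : (s : ℂ) ∈ spectrum ℂ (boundedTransform T hT)) : ((u s : ℝ) : ℂ) ∈ opSpectrum T := by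
  by_contra hc
  obtain ⟨K, hK⟩ := exists_norm_le_of_notMem_opSpectrum hT hc
  have hq0 : 0 < 1 - s ^ 2 := by nlinarith [hs.1, hs.2]
  obtain ⟨q, hq, hqs⟩ : ∃ q : ℝ, 0 < q ∧ √(1 - s ^ 2) = q := ⟨_, Real.sqrt_pos.2 hq0, rfl⟩
  have hq2 : q ^ 2 = 1 - s ^ 2 := by rw [← hqs, Real.sq_sqrt hq0.le]
  have hu : u s * q = s := by rw [u, hqs]; field_simp
  have hs1 : |s| ≤ 1 := abs_le.2 ⟨hs.1.le, hs.2.le⟩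
  refine h ?_
  have hA : IsSelfAdjoint (algebraMap ℂ (H →L[ℂ] H) (s : ℂ) - boundedTransform T hT) :=
    (IsSelfAdjoint.algebraMap _ (Complex.conj_ofReal s)).sub (isSelfAdjoint_boundedTransform T hT)
  refine isUnit_of_isSelfAdjoint_of_norm_le hA
    (c := ⟨(K * (1 + |u s| * (2 / q)) + 2 / q) / q, by positivity⟩) fun x => ?_
  have hw : ‖(algebraMap ℂ (H →L[ℂ] H) (s : ℂ) - boundedTransform T hT) x‖ =
      ‖boundedTransform T hT x - (s : ℂ) • x‖ := by
    rw [norm_sub_rev]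
    simp [Algebra.algebraMap_eq_smul_one]
  rw [hw]
  set w := boundedTransform T hT x - (s : ℂ) • x with hwdef
  set v := CFC.sqrt (invOnePlusSq T hT) x - (q : ℂ) • x with hvdef
  have hv : q * ‖v‖ ≤ 2 * ‖w‖ := by
    refine (mul_norm_le_norm_add_smul (CFC.sqrt_nonneg (invOnePlusSq T hT)) v).trans ?_
    have h1 : CFC.sqrt (invOnePlusSq T hT) v + (q : ℂ) • v =
        -(boundedTransform T hT w + (s : ℂ) • w) := by
      rw [hvdef, hwdef, map_sub, map_sub, map_smul, map_smul, sqrt_sqrt,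
        boundedTransform_boundedTransform, smul_sub, smul_sub, smul_smul, smul_smul]
      have h2 : (q : ℂ) * q = 1 - s * s := by
        rw [← sq, ← sq]; exact_mod_cast hq2
      rw [h2, sub_smul, one_smul]
      abel
    rw [h1, norm_neg]
    refine (norm_add_le _ _).trans ?_
    rw [norm_smul, Complex.norm_real, Real.norm_eq_abs]
    nlinarith [norm_boundedTransform_apply_le T hT w, norm_nonneg w]
  have hv' : ‖v‖ ≤ 2 / q * ‖w‖ := by
    rw [div_mul_eq_mul_div, le_div_iff₀ hq]; linarith
  have h1 := hK _ _ (sqrt_boundedTransform_mem_graph T hT x)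
  have h2 : boundedTransform T hT x - ((u s : ℝ) : ℂ) • CFC.sqrt (invOnePlusSq T hT) x =
      w - ((u s : ℝ) : ℂ) • v := by
    rw [hvdef, hwdef, smul_sub, smul_smul, ← Complex.ofReal_mul, hu]
    abel
  rw [h2] at h1
  have h3 : ‖w - ((u s : ℝ) : ℂ) • v‖ ≤ ‖w‖ + |u s| * (2 / q * ‖w‖) := by
    refine (norm_sub_le _ _).trans ?_
    rw [norm_smul, Complex.norm_real, Real.norm_eq_abs]
    gcongr
  have h4 : q * ‖x‖ ≤ ‖CFC.sqrt (invOnePlusSq T hT) x‖ + ‖v‖ := by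
    have : (q : ℂ) • x = CFC.sqrt (invOnePlusSq T hT) x - v := by rw [hvdef]; abel
    calc q * ‖x‖ = ‖(q : ℂ) • x‖ := by
          rw [norm_smul, Complex.norm_real, Real.norm_of_nonneg hq.le]
      _ ≤ _ := by rw [this]; exact norm_sub_le _ _
  have h5 : q * ‖x‖ ≤ (K * (1 + |u s| * (2 / q)) + 2 / q) * ‖w‖ := by
    have := mul_le_mul_of_nonneg_left h3 K.2
    calc _ ≤ _ := h4
      _ ≤ K * (‖w‖ + |u s| * (2 / q * ‖w‖)) + 2 / q * ‖w‖ := add_le_add (h1.trans this) hv'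
      _ = _ := by ring
  change ‖x‖ ≤ (K * (1 + |u s| * (2 / q)) + 2 / q) / q * ‖w‖
  rw [div_mul_eq_mul_div, le_div_iff₀ hq]
  linarith

theorem u_re_mem_opSpectrum (t : spectrum ℂ (boundedTransform T hT))
    (ht : (t : ℂ).re ∈ Set.Ioo (-1 : ℝ) 1) : ((u (t : ℂ).re : ℝ) : ℂ) ∈ opSpectrum T := by
  refine u_mem_opSpectrum T hT ht ?_
  rw [← (isSelfAdjoint_boundedTransform T hT).mem_spectrum_eq_re t.2]
  exact t.2

/-! Functions of a self-adjoint operator -/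

theorem measurable_u : Measurable u := by
  unfold u; fun_prop

theorem measurable_compU {f : opSpectrum T → ℂ} (hf : Measurable f) :
    Measurable (compU T hT f) := by
  classical
  let s : Set (spectrum ℂ (boundedTransform T hT)) := {t | (t : ℂ).re ∈ Set.Ioo (-1 : ℝ) 1}
  have hre : Measurable fun t : spectrum ℂ (boundedTransform T hT) => (t : ℂ).re :=
    Complex.measurable_re.comp measurable_subtype_coe
  have hs : MeasurableSet s := hre measurableSet_Ioo
  have h1 : compU T hT f = fun t => if h : t ∈ s then
      f ⟨((u (t : ℂ).re : ℝ) : ℂ), u_re_mem_opSpectrum T hT t h⟩ else 0 := by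
    ext t
    by_cases h : t ∈ s
    · rw [compU, dif_pos h, dif_pos ⟨h, u_re_mem_opSpectrum T hT t h⟩]
    · rw [compU, dif_neg h, dif_neg fun h' => h h'.1]
  rw [h1]
  refine Measurable.dite (f := fun t : s => f ⟨((u (t.1 : ℂ).re : ℝ) : ℂ),
    u_re_mem_opSpectrum T hT t.1 t.2⟩) (g := fun _ => 0) (hf.comp ?_) measurable_const hs
  exact (Complex.measurable_ofReal.comp
    (measurable_u.comp (hre.comp measurable_subtype_coe))).subtype_mk

theorem norm_compU_le {f : opSpectrum T → ℂ} {C : ℝ} (h0 : 0 ≤ C) (hC : ∀ x, ‖f x‖ ≤ C)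
    (t : spectrum ℂ (boundedTransform T hT)) : ‖compU T hT f t‖ ≤ C := by
  unfold compU
  split_ifs with h
  · exact hC _
  · simpa using h0

/-- The function `f ∘ u` on `σ(S)` for a bounded Borel function `f` on `σ(T)`. -/
def boundedCompU (f : boundedBorel (opSpectrum T)) :
    boundedBorel (spectrum ℂ (boundedTransform T hT)) :=
  -- The bound must also cover the default value 0, and the chosen bound of f could be negative if
  -- σ(T) were empty.
  ⟨compU T hT f, measurable_compU T hT f.2.1, max f.2.2.choose 0,
    norm_compU_le T hT (le_max_right _ _) fun x => (f.2.2.choose_spec x).trans (le_max_left _ _)⟩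

theorem boundedCompU_add (f g : boundedBorel (opSpectrum T)) :
    boundedCompU T hT (f + g) = boundedCompU T hT f + boundedCompU T hT g := by
  ext t
  change compU T hT (f + g) t = compU T hT f t + compU T hT g t
  unfold compU
  split_ifs <;> simp

theorem boundedCompU_mul (f g : boundedBorel (opSpectrum T)) :
    boundedCompU T hT (f * g) = boundedCompU T hT f * boundedCompU T hT g := by
  ext t
  change compU T hT (f * g) t = compU T hT f t * compU T hT g t
  unfold compU
  split_ifs <;> simp

theorem boundedCompU_star (f : boundedBorel (opSpectrum T)) :
    boundedCompU T hT (star f) = star (boundedCompU T hT f) := by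
  ext t
  change compU T hT (star (f : opSpectrum T → ℂ)) t = star (compU T hT f t)
  unfold compU
  split_ifs <;> simp

/-- Equality holds only almost everywhere, since constants composed with u become 0 at ±1. Unitality
of f ↦ f(T) rests on this. -/
theorem boundedCompU_algebraMap_ae (c : ℂ) (hS : IsStarNormal (boundedTransform T hT)) (x : H) :
    (boundedCompU T hT (algebraMap ℂ _ c) : spectrum ℂ (boundedTransform T hT) → ℂ)
      =ᵐ[spectralMeasure hS x] (c • (1 : boundedBorel (spectrum ℂ (boundedTransform T hT))) :
        boundedBorel (spectrum ℂ (boundedTransform T hT))) := by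
  filter_upwards [ae_sq_ne_one T hT hS x] with t ht
  have h1 := re_mem_Ioo_of_mem_spectrum T hT t.2 ht
  change compU T hT (fun _ => c) t = c * 1
  rw [compU, dif_pos ⟨h1, u_re_mem_opSpectrum T hT t h1⟩, mul_one]

/-- The bounded operator `f(T)` for a bounded Borel function `f` on `σ(T)`. -/
def boundedBorelFunction (f : boundedBorel (opSpectrum T)) : H →L[ℂ] H :=
  boundedBorelCalculus (isSelfAdjoint_boundedTransform T hT).isStarNormal (boundedCompU T hT f)

theorem borelFunction_eq_boundedBorelFunction (f : boundedBorel (opSpectrum T)) :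
    borelFunction T hT f = (boundedBorelFunction T hT f : H →ₗ[ℂ] H).toPMap ⊤ :=
  borelCalculus_eq_boundedBorelCalculus (isSelfAdjoint_boundedTransform T hT).isStarNormal
    (boundedCompU T hT f)

theorem boundedBorelFunction_mem_wStar (f : boundedBorel (opSpectrum T)) :
    boundedBorelFunction T hT f ∈ wStar T hT := by
  rw [← SetLike.mem_coe, wStar, coe_vnCommutant]
  exact fun R hR => boundedBorelCalculus_comm _ (commute_cfcHom T hT hR _) _

theorem boundedBorelFunction_algebraMap (c : ℂ) :
    boundedBorelFunction T hT (algebraMap ℂ _ c) = algebraMap ℂ _ c := by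
  rw [boundedBorelFunction, boundedBorelCalculus_congr _
    (boundedCompU_algebraMap_ae T hT c _), boundedBorelCalculus_smul, boundedBorelCalculus_one,
    Algebra.algebraMap_eq_smul_one]

/-- The `*`-homomorphism `f ↦ f(T)` from the bounded Borel functions on `σ(T)` to `W*(T)`. -/
def borelHom : boundedBorel (opSpectrum T) →⋆ₐ[ℂ] (wStar T hT).toStarSubalgebra where
  toFun f := ⟨boundedBorelFunction T hT f, boundedBorelFunction_mem_wStar T hT f⟩
  map_one' := Subtype.ext <| by
    simpa using boundedBorelFunction_algebraMap T hT 1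
  map_zero' := Subtype.ext <| by
    simpa using boundedBorelFunction_algebraMap T hT 0
  map_add' f g := Subtype.ext <| by
    simp [boundedBorelFunction, boundedCompU_add, boundedBorelCalculus_add]
  map_mul' f g := Subtype.ext <| by
    simp [boundedBorelFunction, boundedCompU_mul, boundedBorelCalculus_mul]
  map_star' f := Subtype.ext <| by
    simp [boundedBorelFunction, boundedCompU_star, boundedBorelCalculus_star]
  commutes' c := Subtype.ext <| boundedBorelFunction_algebraMap T hT c

theorem norm_boundedBorelFunction_le (f : boundedBorel (opSpectrum T)) :
    ‖boundedBorelFunction T hT f‖ ≤ ⨆ x, ‖(f : opSpectrum T → ℂ) x‖ := by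
  have h0 : 0 ≤ ⨆ x, ‖(f : opSpectrum T → ℂ) x‖ := Real.iSup_nonneg fun _ => norm_nonneg _
  refine norm_boundedBorelCalculus_le _ _ h0 (norm_compU_le T hT h0 fun x => ?_)
  obtain ⟨C, hC⟩ := f.2.2
  exact le_ciSup (f := fun x => ‖(f : opSpectrum T → ℂ) x‖) ⟨C, by rintro _ ⟨y, rfl⟩; exact hC y⟩ x

theorem affiliated_borelFunction {f : opSpectrum T → ℂ} (hf : Measurable f) :
    Affiliated (borelFunction T hT f) (wStar T hT) where
  dense := dense_domain_borelCalculus _ (measurable_compU T hT hf)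
  isClosed := isClosed_borelCalculus _ (measurable_compU T hT hf)
  commutes _ hR := commutes_borelCalculus _ (measurable_compU T hT hf)
    (commute_cfcHom T hT (mem_commutant_of_mem_wStar_commutant T hT hR) _)

end

end BoundedTransform

end

theorem theorem4 {H : Type*} [NormedAddCommGroup H] [InnerProductSpace ℂ H] [CompleteSpace H]
    (T : H →ₗ.[ℂ] H) (hT : IsSelfAdjoint T) :
    BoundedTransform.wStar T hT =
        BoundedTransform.wStarBounded (BoundedTransform.boundedTransform T hT) ∧
      (∃ Φ : BoundedTransform.boundedBorel (BoundedTransform.opSpectrum T) →⋆ₐ[ℂ]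
          (BoundedTransform.wStar T hT).toStarSubalgebra,
        ∀ f : BoundedTransform.boundedBorel (BoundedTransform.opSpectrum T),
          BoundedTransform.borelFunction T hT f =
              ((Φ f : H →L[ℂ] H) : H →ₗ[ℂ] H).toPMap ⊤ ∧
            ‖(Φ f : H →L[ℂ] H)‖ ≤ ⨆ x, ‖(f : BoundedTransform.opSpectrum T → ℂ) x‖) ∧
      ∀ f : BoundedTransform.opSpectrum T → ℂ, Measurable f →
        BoundedTransform.Affiliated (BoundedTransform.borelFunction T hT f)
          (BoundedTransform.wStar T hT) := by
  exact ⟨BoundedTransform.wStar_eq_wStarBounded T hT,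
    ⟨BoundedTransform.borelHom T hT, fun f =>
      ⟨BoundedTransform.borelFunction_eq_boundedBorelFunction T hT f,
        BoundedTransform.norm_boundedBorelFunction_le T hT f⟩⟩,
    fun f hf => BoundedTransform.affiliated_borelFunction T hT hf⟩
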